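/- For $n\ge 1$ and sequences $(a_j)_{j\in\mathbb Z},(b_j)_{j\in\mathbb Z}$ of complex numbers, let $T_{n,g}$ be the $n\times n$ matrix whose $(i,j)$ entry ($1\le i,j\le n$) is $a_{i-j}$ if $i+j\le n$ and $b_{i-j}$ if $i+j\ge n+1$; let $P_n$ be the backward identity permutation matrix, and let $H_n=P_nT_{n,g}$ be the asymmetric Hankel matrix with inputs $(a_j),(b_j)$. For a random $n\times n$ matrix $B$ put $\varphi_n(B)=\frac1n\mathbf E[\operatorname{Tr}B]$. Assumption. For every $n$, the pairs $(a_{j,n},b_{j,n})$, $j\in\mathbb Z$, of complex random variables $a_{j,n}=x_{j,n}+\mathrm i y_{j,n}$, $b_{j,n}=x'_{j,n}+\mathrm i y'_{j,n}$ are independent across $j$; all variables satisfy $\mathbf E a_{j,n}=\mathbf E b_{j,n}=0$, $\mathbf E|a_{j,n}|^2=\mathbf E|b_{j,n}|^2=1$, $\mathbf E x_{j,n}^2=\mathbf E y_{j,n}^2$ and $\mathbf E x_{j,n}'^2=\mathbf E y_{j,n}'^2$; for all $j,n$, $$\mathbf E[x_{j,n}y_{j,n}]=\rho_1,\quad \mathbf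 E[x_{j,n}x'_{j,n}]=\rho_2,\quad \mathbf E[x_{j,n}y'_{j,n}]=\rho_3,\quad \mathbf E[x'_{j,n}y_{j,n}]=\rho_4,\quad \mathbf E[x'_{j,n}y'_{j,n}]=\rho_5,\quad \mathbf E[y_{j,n}y'_{j,n}]=\rho_6;$$ and for every $k\ge1$ the $k$-th absolute moments of $x_{j,n},y_{j,n},x'_{j,n},y'_{j,n}$ are bounded by a constant $c_k<\infty$ that does not depend on $j,n$. Statement. Let $H_n^{(1)},\dots,H_n^{(m)}$ be independent Hankel matrices whose inputs all satisfy the Assumption with the same $\rho_1,\dots,\rho_6$. Then $n^{-1/2}H_n^{(1)},\dots,n^{-1/2}H_n^{(m)}$ converge jointly in $*$-distribution: there are a unital complex $*$-algebra $\mathcal A$, a linear functional $\varphi$ on $\mathcal A$ with $\varphi(1)=1$ and $\varphi(aa^*)\ge0$ for all $a$, and elements $h_1,\dots,h_m\in\mathcal A$ such that for all $p$, $\epsilon_1,\dots,\epsilon_p\in\{1,*\}$ and $\tau_1,\dots,\tau_p\in\{1,\dots,m\}$, $$\lim_{n\to\infty}\varphi_n\Big(\tfrac{H_n^{(\tau_1)\epsilon_1}}{n^{1/2}}\cdots\tfrac{H_n^{(\tau_p)\epsilon_p}}{n^{1/2}}\Big)=\varphi\big(h_{\tau_1}^{\epsilon_1}\cdots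 h_{\tau_p}^{\epsilon_p}\big).$$ This limit is $0$ if $p$ is odd, and if $p=2k$ it equals $$\sum_{\pi\in\mathcal P_2(2k)}\int_0^1\int_{[-1,1]^k}\prod_{(r,s)\in\pi}\delta_{\tau_r,\tau_s}\,\mathcal E^{(H)}_{r,s}(z_0,\dots,z_k)\,dz_1\cdots dz_k\,dz_0 ,$$ where $\mathcal P_2(2k)$ is the set of pair partitions $\pi=\{(r_1,s_1),\dots,(r_k,s_k)\}$ of $\{1,\dots,2k\}$ with $r_1<\dots<r_k$ and $r_t<s_t$, and $\mathcal E^{(H)}_{r,s}$ is defined as follows. Let $\pi'(r_t)=\pi'(s_t)=t$; $\epsilon'=1$ if $\epsilon=1$ and $\epsilon'=-1$ if $\epsilon=*$; $\nu_t=(-1)^t$; $0^0=1$; $$\tilde{\mathcal A}_z=[\max\{0,-z\},\tfrac12(1-z)],\qquad \tilde{\mathcal B}_z=[\tfrac12(1-z),\min\{1-z,1\}];$$ $$w_t=z_0+\sum_{\ell=t+1}^{2k}\nu_\ell z_{\pi'(\ell)},\qquad u_t=\begin{cases}w_t&\text{if }\epsilon'_t\nu_t=1,\\1-w_t&\text{if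 }\epsilon'_t\nu_t=-1,\end{cases}$$ $$\alpha_t=\mathbf 1_{\tilde{\mathcal A}_{\epsilon'_tz_{\pi'(t)}}}(u_t),\qquad \beta_t=\mathbf 1_{\tilde{\mathcal B}_{\epsilon'_tz_{\pi'(t)}}}(u_t).$$ With $d=\delta_{\epsilon_r,\epsilon_s}$ and $\kappa(e)=[\rho_2+\rho_6+e\,\mathrm i(\rho_4-\rho_3)]^{1-d}\,[\rho_2-\rho_6+e\,\mathrm i(\rho_4+\rho_3)]^{d}$, $$\mathcal E^{(H)}_{r,s}=\Big[[2\mathrm i\epsilon'_r\rho_1]^{d}\alpha_r\alpha_s+[2\mathrm i\epsilon'_r\rho_5]^{d}\beta_r\beta_s+\kappa(\epsilon'_r)\,\alpha_r\beta_s+\kappa(\epsilon'_s)\,\beta_r\alpha_s\Big](1-\delta_{\nu_r,\nu_s}).$$ -/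

import Mathlib

open MeasureTheory ProbabilityTheory Filter Topology

noncomputable section

/-- An exponent in `{1, *}`. -/
inductive StarExp
  | one
  | star
  deriving DecidableEq

/-- `x ^ ε` for `ε ∈ {1, *}`. -/
def StarExp.app {A : Type*} [Star A] (ε : StarExp) (x : A) : A :=
  match ε with
  | .one => x
  | .star => Star.star x

/-- The sign `ε'`, which is `1` for `ε = 1` and `-1` for `ε = *`. -/
def StarExp.sign (ε : StarExp) : ℤ :=
  match ε with
  | .one => 1
  | .star => -1

/-- The monomial `h_{τ₁}^{ε₁} ⋯ h_{τ_p}^{ε_p}`. -/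
def starWord {A : Type*} [Monoid A] [Star A] {m p : ℕ}
    (h : Fin m → A) (τ : Fin p → Fin m) (ε : Fin p → StarExp) : A :=
  (List.ofFn fun t => (ε t).app (h (τ t))).prod

/-- A state on a unital complex `*`-algebra: `φ(1) = 1` and `φ(a a*) ≥ 0`. A `*`-probability
space is a unital complex `*`-algebra with such a functional. -/
structure IsStarState {A : Type*} [Ring A] [StarRing A] [Algebra ℂ A]
    (φ : A →ₗ[ℂ] ℂ) : Prop where
  map_one : φ 1 = 1
  nonneg : ∀ a : A, 0 ≤ (φ (a * star a)).re ∧ (φ (a * star a)).im = 0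

/-- `φ_n(B) = n⁻¹ E[Tr B]` for a random `n × n` matrix `B`. -/
def expTrace {Ω : Type*} [MeasurableSpace Ω] (P : Measure Ω) {n : ℕ}
    (B : Ω → Matrix (Fin n) (Fin n) ℂ) : ℂ :=
  (n : ℂ)⁻¹ * ∫ ω, (B ω).trace ∂P

/-- Joint convergence in `*`-distribution of `m` sequences of random matrices to the elements
`h 0, …, h (m - 1)` of `(A, φ)`. -/
def ConvergesInStarDistribution {Ω : ℕ → Type*} [∀ n, MeasurableSpace (Ω n)]
    (P : ∀ n, Measure (Ω n)) {m : ℕ}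
    (M : ∀ n, Fin m → Ω n → Matrix (Fin n) (Fin n) ℂ)
    {A : Type*} [Ring A] [StarRing A] [Algebra ℂ A] (φ : A →ₗ[ℂ] ℂ) (h : Fin m → A) : Prop :=
  ∀ (p : ℕ) (τ : Fin p → Fin m) (ε : Fin p → StarExp),
    Tendsto (fun n => expTrace (P n) (fun ω => starWord (fun i => M n i ω) τ ε))
      atTop (𝓝 (φ (starWord h τ ε)))

/-- The backward identity permutation matrix `P_n`. -/
def backwardIdentity (n : ℕ) : Matrix (Fin n) (Fin n) ℂ :=
  Matrix.of fun i j => if j = Fin.rev i then 1 else 0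

/-- The generalized Toeplitz matrix `T_{n,g}`: with indices starting from `1`, its `(i, j)` entry
is `a_{i-j}` if `i + j ≤ n` and `b_{i-j}` if `i + j ≥ n + 1`. -/
def genToeplitz (n : ℕ) (a b : ℤ → ℂ) : Matrix (Fin n) (Fin n) ℂ :=
  Matrix.of fun i j =>
    if (i.val + 1) + (j.val + 1) ≤ n then a ((i.val : ℤ) - (j.val : ℤ))
    else b ((i.val : ℤ) - (j.val : ℤ))

/-- The asymmetric Hankel matrix `H_n = P_n T_{n,g}`. -/
def hankel (n : ℕ) (a b : ℤ → ℂ) : Matrix (Fin n) (Fin n) ℂ :=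
  backwardIdentity n * genToeplitz n a b

/-- The six correlation parameters. -/
structure Correlations where
  ρ₁ : ℝ
  ρ₂ : ℝ
  ρ₃ : ℝ
  ρ₄ : ℝ
  ρ₅ : ℝ
  ρ₆ : ℝ

/-- The complex variable with real part `x` and imaginary part `y`. -/
def toComplex {Ω : Type*} (x y : Ω → ℝ) (ω : Ω) : ℂ := (x ω : ℂ) + Complex.I * (y ω : ℂ)

/-- The assumption on the input variables `a_{j,n} = x_{j,n} + i y_{j,n}` and
`b_{j,n} = x'_{j,n} + i y'_{j,n}` (written `u` and `v` for `x'` and `y'`): the pairs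
`(a_{j,n}, b_{j,n})` are independent across `j`, all variables are centred with variance one, the
real and imaginary parts have equal second moments, the correlations inside a pair are
`ρ₁, …, ρ₆`, and all moments are bounded uniformly in `j` and `n`. -/
structure InputAssumption {Ω : ℕ → Type*} [∀ n, MeasurableSpace (Ω n)]
    (P : ∀ n, Measure (Ω n)) (ρ : Correlations) (x y u v : ∀ n, ℤ → Ω n → ℝ) : Prop where
  measurable_x : ∀ n j, Measurable (x n j)
  measurable_y : ∀ n j, Measurable (y n j)
  measurable_u : ∀ n j, Measurable (u n j)
  measurable_v : ∀ n j, Measurable (v n j)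
  indep : ∀ n, iIndepFun
    (fun (j : ℤ) (ω : Ω n) => (toComplex (x n j) (y n j) ω, toComplex (u n j) (v n j) ω)) (P n)
  mean_a : ∀ n j, ∫ ω, toComplex (x n j) (y n j) ω ∂(P n) = 0
  mean_b : ∀ n j, ∫ ω, toComplex (u n j) (v n j) ω ∂(P n) = 0
  variance_a : ∀ n j, ∫ ω, ‖toComplex (x n j) (y n j) ω‖ ^ 2 ∂(P n) = 1
  variance_b : ∀ n j, ∫ ω, ‖toComplex (u n j) (v n j) ω‖ ^ 2 ∂(P n) = 1
  balanced_a : ∀ n j, ∫ ω, x n j ω ^ 2 ∂(P n) = ∫ ω, y n j ω ^ 2 ∂(P n)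
  balanced_b : ∀ n j, ∫ ω, u n j ω ^ 2 ∂(P n) = ∫ ω, v n j ω ^ 2 ∂(P n)
  corr₁ : ∀ n j, ∫ ω, x n j ω * y n j ω ∂(P n) = ρ.ρ₁
  corr₂ : ∀ n j, ∫ ω, x n j ω * u n j ω ∂(P n) = ρ.ρ₂
  corr₃ : ∀ n j, ∫ ω, x n j ω * v n j ω ∂(P n) = ρ.ρ₃
  corr₄ : ∀ n j, ∫ ω, u n j ω * y n j ω ∂(P n) = ρ.ρ₄
  corr₅ : ∀ n j, ∫ ω, u n j ω * v n j ω ∂(P n) = ρ.ρ₅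
  corr₆ : ∀ n j, ∫ ω, y n j ω * v n j ω ∂(P n) = ρ.ρ₆
  moments : ∃ c : ℕ → ℝ, ∀ k, 1 ≤ k → ∀ n j,
    (Integrable (fun ω => |x n j ω| ^ k) (P n) ∧ ∫ ω, |x n j ω| ^ k ∂(P n) ≤ c k) ∧
    (Integrable (fun ω => |y n j ω| ^ k) (P n) ∧ ∫ ω, |y n j ω| ^ k ∂(P n) ≤ c k) ∧
    (Integrable (fun ω => |u n j ω| ^ k) (P n) ∧ ∫ ω, |u n j ω| ^ k ∂(P n) ≤ c k) ∧
    (Integrable (fun ω => |v n j ω| ^ k) (P n) ∧ ∫ ω, |v n j ω| ^ k ∂(P n) ≤ c k)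

/-- A pair partition `{(r₁,s₁), …, (r_k,s_k)}` of a set of `2k` points, written with
`r₁ < ⋯ < r_k` and `r_t < s_t`. -/
@[ext]
structure PairPartition (k : ℕ) where
  r : Fin k → Fin (2 * k)
  s : Fin k → Fin (2 * k)
  r_strictMono : StrictMono r
  r_lt_s : ∀ t, r t < s t
  cover : ∀ i, ∃! t, i = r t ∨ i = s t

instance (k : ℕ) : Fintype (PairPartition k) :=
  @Fintype.ofFinite _ (Finite.of_injective (fun π : PairPartition k => (π.r, π.s))
    (fun _ _ h => PairPartition.ext (congrArg Prod.fst h) (congrArg Prod.snd h)))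

namespace PairPartition

/-- The projection `π'`: the label of the block that contains `i`. -/
def block {k : ℕ} (π : PairPartition k) (i : Fin (2 * k)) : Fin k := (π.cover i).choose

end PairPartition

/-- `ν_t = 1` for even `t` and `-1` for odd `t`, where the positions are numbered from `1` to `2k`
(so `t : Fin (2 * k)` stands for the position `t + 1`). -/
def nu {k : ℕ} (t : Fin (2 * k)) : ℤ := if Even (t.val + 1) then 1 else -1

/-- The interval `Ã_z = [max(0,-z), (1-z)/2]`. -/
def limA (z : ℝ) : Set ℝ := Set.Icc (max 0 (-z)) ((1 - z) / 2)

/-- The interval `B̃_z = [(1-z)/2, min(1-z,1)]`. -/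
def limB (z : ℝ) : Set ℝ := Set.Icc ((1 - z) / 2) (min (1 - z) 1)

/-- `z₀ + ∑_{ℓ > t} ν_ℓ z_{π'(ℓ)}`. -/
def tailSum {k : ℕ} (π : PairPartition k) (z₀ : ℝ) (z : Fin k → ℝ) (t : Fin (2 * k)) : ℝ :=
  z₀ + ∑ ℓ ∈ Finset.Ioi t, (nu ℓ : ℝ) * z (π.block ℓ)

/-- The rescaled column of `T_{n,g}` or of `T_{n,g}^*` that the `t`-th factor of the trace uses.
The factors `P_n` in `H_n = P_n T_{n,g}` and `H_n^* = T_{n,g}^* P_n` reflect the column at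
every other step. -/
def pathPoint {k : ℕ} (π : PairPartition k) (ε : Fin (2 * k) → StarExp) (z₀ : ℝ) (z : Fin k → ℝ)
    (t : Fin (2 * k)) : ℝ :=
  if (ε t).sign * nu t = 1 then tailSum π z₀ z t else 1 - tailSum π z₀ z t

/-- The indicator that the `t`-th factor is an `a`-entry, in the limit. -/
def indA {k : ℕ} (π : PairPartition k) (ε : Fin (2 * k) → StarExp) (z₀ : ℝ) (z : Fin k → ℝ)
    (t : Fin (2 * k)) : ℂ :=
  (limA (((ε t).sign : ℝ) * z (π.block t))).indicator (fun _ => 1) (pathPoint π ε z₀ z t)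

/-- The indicator that the `t`-th factor is a `b`-entry, in the limit. -/
def indB {k : ℕ} (π : PairPartition k) (ε : Fin (2 * k) → StarExp) (z₀ : ℝ) (z : Fin k → ℝ)
    (t : Fin (2 * k)) : ℂ :=
  (limB (((ε t).sign : ℝ) * z (π.block t))).indicator (fun _ => 1) (pathPoint π ε z₀ z t)

/-- The Kronecker delta as a natural number. -/
def kron {α : Type*} [DecidableEq α] (i j : α) : ℕ := if i = j then 1 else 0

/-- The coefficient of a mixed pair, an `a`-entry with exponent of sign `e` and a `b`-entry; `d` is
`1` if the two exponents agree and `0` otherwise. -/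
def mixedCoeff (ρ : Correlations) (e : ℤ) (d : ℕ) : ℂ :=
  ((ρ.ρ₂ + ρ.ρ₆ : ℂ) + (e : ℂ) * Complex.I * (ρ.ρ₄ - ρ.ρ₃ : ℂ)) ^ (1 - d) *
    ((ρ.ρ₂ - ρ.ρ₆ : ℂ) + (e : ℂ) * Complex.I * (ρ.ρ₄ + ρ.ρ₃ : ℂ)) ^ d

/-- The function `E^{(H)}_{r,s}(z₀, z)`. -/
def hankelE {k : ℕ} (ρ : Correlations) (π : PairPartition k) (ε : Fin (2 * k) → StarExp)
    (r s : Fin (2 * k)) (z₀ : ℝ) (z : Fin k → ℝ) : ℂ :=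
  (((((ε r).sign : ℂ) * 2 * Complex.I * (ρ.ρ₁ : ℂ)) ^ kron (ε r) (ε s)) *
      (indA π ε z₀ z r * indA π ε z₀ z s) +
    ((((ε r).sign : ℂ) * 2 * Complex.I * (ρ.ρ₅ : ℂ)) ^ kron (ε r) (ε s)) *
      (indB π ε z₀ z r * indB π ε z₀ z s) +
    mixedCoeff ρ (ε r).sign (kron (ε r) (ε s)) * (indA π ε z₀ z r * indB π ε z₀ z s) +
    mixedCoeff ρ (ε s).sign (kron (ε r) (ε s)) * (indB π ε z₀ z r * indA π ε z₀ z s)) *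
  (1 - (kron (nu r) (nu s) : ℂ))

/-- The limiting even `*`-moment: the sum over pair partitions of
`∫_0^1 ∫_{[-1,1]^k} ∏_{(r,s) ∈ π} δ_{τ_r,τ_s} E^{(H)}_{r,s}`. -/
def hankelMoment {m k : ℕ} (ρ : Correlations) (τ : Fin (2 * k) → Fin m)
    (ε : Fin (2 * k) → StarExp) : ℂ :=
  ∑ π : PairPartition k,
    ∫ z₀ in Set.Icc (0 : ℝ) 1, ∫ z in Set.Icc (fun _ : Fin k => (-1 : ℝ)) (fun _ => 1),
      ∏ t : Fin k, (kron (τ (π.r t)) (τ (π.s t)) : ℂ) * hankelE ρ π ε (π.r t) (π.s t) z₀ z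

end

/-! The proof is the moment method. The trace of a word of length p is a sum over closed index paths
in `Fin n`. A step from i to j (counted from 0) reads the input with index n - 1 - i - j, so a path
is determined by its end point and its p input indices. Centring and independence kill every path on
which some input pair occurs exactly once. Paths with fewer than p/2 distinct input pairs number
O(n^(1+B)) with B = ⌊(p-1)/2⌋, which is negligible against the normalization n^(1+p/2). On the
remaining paths every input pair occurs exactly twice; this forces p to be even, and the expectation
is a product of covariances over a unique pair partition (`fiber_trichotomy`,
`PairFamily.integral_eq_wickSum`). Hence the expectation can be replaced by `wickSum` on all closed
paths at vanishing cost (`tendsto_degenerate`), and the sums over paths and over pair partitions can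
be exchanged.

For a fixed pair partition, reflecting every other vertex turns a path into a walk with increments
ν_t J_{π'(t)}. Matched closed paths become lattice points (q, J) in [0, n) × [-n, n)^k, subject to
the closing equation ∑ ν_ℓ J_{π'(ℓ)} = 0 and to inequalities that keep the vertices in range and
tell a-entries from b-entries (`sum_matched_paths`). The closing equation is vacuous if every pair
joins positions of opposite parity; otherwise it cuts out a hyperplane that does not contribute in
the limit, whence the factor 1 - δ. The normalized lattice sum is the integral of a step function,
which converges off finitely many hyperplanes; dominated convergence gives the limit integral
(`ae_tendsto_latticeWeight`, `tendsto_sum_latticeWeight`).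

The limit elements are the generators of the free `*`-algebra, with the limit moments as the
functional; positivity survives the limit (`exists_limit_state`). -/

namespace PairPartition

variable {k : ℕ} (π : PairPartition k)

lemma block_spec (i : Fin (2 * k)) : i = π.r (π.block i) ∨ i = π.s (π.block i) :=
  (π.cover i).choose_spec.1

lemma block_eq {i : Fin (2 * k)} {t : Fin k} (h : i = π.r t ∨ i = π.s t) : π.block i = t :=
  (π.cover i).unique (π.block_spec i) h

@[simp] lemma block_r (t : Fin k) : π.block (π.r t) = t := π.block_eq (Or.inl rfl)

@[simp] lemma block_s (t : Fin k) : π.block (π.s t) = t := π.block_eq (Or.inr rfl)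

lemma r_ne_s (t : Fin k) : π.r t ≠ π.s t := (π.r_lt_s t).ne

end PairPartition

/-! ### Fibres of a key map and the pair partitions they induce -/

section Fibers

variable {κ : Type*} [DecidableEq κ]

lemma mem_pair_of_card_fiber_eq_two {p : ℕ} {K : Fin p → κ} {a b j : Fin p}
    (h : (Finset.univ.filter fun i => K i = K a).card = 2) (hab : a ≠ b) (hb : K b = K a)
    (hj : K j = K a) : j = a ∨ j = b := by
  have hsub : ({a, b} : Finset (Fin p)) ⊆ Finset.univ.filter fun i => K i = K a := by
    intro i hi
    rcases Finset.mem_insert.1 hi with rfl | hi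
    · simp
    · rw [Finset.mem_singleton] at hi
      subst hi
      simpa using hb
  have heq := Finset.eq_of_subset_of_card_le hsub (by rw [h, Finset.card_pair hab])
  have : j ∈ ({a, b} : Finset (Fin p)) := by
    rw [heq]
    simpa using hj
  simpa using this

lemma sum_card_fiber {p : ℕ} (K : Fin p → κ) :
    ∑ b ∈ Finset.univ.image K, (Finset.univ.filter fun i => K i = b).card = p := by
  have := Finset.card_eq_sum_card_image K (Finset.univ : Finset (Fin p))
  simpa using this.symm

/-- Without an isolated key all fibres have at least two elements. Their sizes add up to p, so
either all are equal to two or there are fewer than p/2 keys. -/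
lemma fiber_trichotomy {p : ℕ} (K : Fin p → κ) :
    (∃ t, ∀ s, K s = K t → s = t) ∨ 2 * (Finset.univ.image K).card < p ∨
      ∀ t, (Finset.univ.filter fun i => K i = K t).card = 2 := by
  by_cases h1 : ∃ t, ∀ s, K s = K t → s = t
  · exact Or.inl h1
  right
  have h2 : ∀ b ∈ Finset.univ.image K, 2 ≤ (Finset.univ.filter fun i => K i = b).card := by
    intro b hb
    obtain ⟨t, -, rfl⟩ := Finset.mem_image.1 hb
    push Not at h1
    obtain ⟨s, hs, hst⟩ := h1 t
    exact Finset.one_lt_card.2 ⟨s, by simpa using hs, t, by simp, hst⟩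
  by_cases h3 : ∀ t, (Finset.univ.filter fun i => K i = K t).card = 2
  · exact Or.inr h3
  left
  push Not at h3
  obtain ⟨t, ht⟩ := h3
  have hlt := Finset.sum_lt_sum h2 ⟨K t, Finset.mem_image_of_mem _ (Finset.mem_univ _),
    lt_of_le_of_ne (h2 _ (Finset.mem_image_of_mem _ (Finset.mem_univ _))) (Ne.symm ht)⟩
  rw [sum_card_fiber] at hlt
  simpa [mul_comm] using hlt

lemma two_mul_card_image_of_fibers {p : ℕ} {K : Fin p → κ}
    (h : ∀ t, (Finset.univ.filter fun i => K i = K t).card = 2) :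
    2 * (Finset.univ.image K).card = p := by
  refine Eq.trans ?_ (sum_card_fiber K)
  rw [Finset.sum_congr rfl (g := fun _ => 2), Finset.sum_const, smul_eq_mul, mul_comm]
  intro b hb
  obtain ⟨t, -, rfl⟩ := Finset.mem_image.1 hb
  exact h t

lemma exists_pairPartition {k : ℕ} {K : Fin (2 * k) → κ}
    (h : ∀ t, (Finset.univ.filter fun i => K i = K t).card = 2) :
    ∃ π : PairPartition k, ∀ t, K (π.r t) = K (π.s t) := by
  have hσ : ∀ i, ∃ j, j ≠ i ∧ K j = K i := by
    intro i
    obtain ⟨j, hj, hji⟩ := Finset.exists_mem_ne (by rw [h i]; norm_num) i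
    exact ⟨j, hji, by simpa using hj⟩
  choose σ hσne hσK using hσ
  have hfib : ∀ i j, K j = K i → j = i ∨ j = σ i := fun i j hj =>
    mem_pair_of_card_fiber_eq_two (h i) (hσne i).symm (hσK i) hj
  -- The left ends are the least elements of the fibres, listed in increasing order; `σ` supplies
  -- the right ends.
  set R : Finset (Fin (2 * k)) := Finset.univ.filter fun i => ∀ j, K j = K i → i ≤ j with hR
  have hRK : ∀ i ∈ R, ∀ j ∈ R, K i = K j → i = j := by
    intro i hi j hj hij
    simp only [hR, Finset.mem_filter, Finset.mem_univ, true_and] at hi hj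
    exact le_antisymm (hi j hij.symm) (hj i hij)
  have hmin : ∀ i, i ∈ R ∨ σ i ∈ R := by
    intro i
    simp only [hR, Finset.mem_filter, Finset.mem_univ, true_and]
    rcases le_total i (σ i) with hle | hle
    · left
      intro j hj
      rcases hfib i j hj with rfl | rfl
      · exact le_rfl
      · exact hle
    · right
      intro j hj
      rcases hfib i j (hj.trans (hσK i)) with rfl | rfl
      · exact hle
      · exact le_rfl
  have hcard : R.card = k := by
    have h1 : R.card = (Finset.univ.image K).card := by
      rw [← Finset.card_image_of_injOn (s := R) (f := K) (fun i hi j hj => hRK i hi j hj)]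
      congr 1
      apply Finset.Subset.antisymm (Finset.image_subset_image (Finset.subset_univ _))
      intro b hb
      obtain ⟨i, -, rfl⟩ := Finset.mem_image.1 hb
      rcases hmin i with hi | hi
      · exact Finset.mem_image_of_mem _ hi
      · exact Finset.mem_image.2 ⟨σ i, hi, hσK i⟩
    have h2 := two_mul_card_image_of_fibers h
    omega
  let r := R.orderEmbOfFin hcard
  have hrR : ∀ t, r t ∈ R := fun t => R.orderEmbOfFin_mem hcard t
  have hrsurj : ∀ i ∈ R, ∃ t, r t = i := by
    intro i hi
    have : i ∈ Set.range r := by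
      rw [Finset.range_orderEmbOfFin]
      exact hi
    exact this
  refine ⟨⟨r, fun t => σ (r t), r.strictMono, ?_, ?_⟩, fun t => (hσK _).symm⟩
  · intro t
    have := hrR t
    simp only [hR, Finset.mem_filter, Finset.mem_univ, true_and] at this
    exact lt_of_le_of_ne (this _ (hσK _)) (hσne _).symm
  · intro i
    have huniq : ∀ t t', (i = r t ∨ i = σ (r t)) → (i = r t' ∨ i = σ (r t')) → t' = t := by
      intro t t' ht ht'
      have e : ∀ t, (i = r t ∨ i = σ (r t)) → K i = K (r t) := by
        rintro t (ht | ht)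
        · rw [ht]
        · rw [ht, hσK]
      exact r.injective (hRK _ (hrR _) _ (hrR _) ((e t' ht').symm.trans (e t ht)))
    obtain ⟨t, ht⟩ : ∃ t, i = r t ∨ i = σ (r t) := by
      rcases hmin i with hi | hi
      · obtain ⟨t, ht⟩ := hrsurj i hi
        exact ⟨t, Or.inl ht.symm⟩
      · obtain ⟨t, ht⟩ := hrsurj _ hi
        refine ⟨t, Or.inr ?_⟩
        rcases hfib (σ i) i (hσK i).symm with hh | hh
        · exact absurd hh.symm (hσne i)
        · rw [ht, ← hh]
    exact ⟨t, ht, fun t' ht' => huniq t t' ht ht'⟩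

/-- The left ends of a compatible partition are exactly the least elements of the fibres, and a
strictly monotone enumeration is determined by its range. -/
lemma pairPartition_unique {k : ℕ} {K : Fin (2 * k) → κ}
    (h : ∀ t, (Finset.univ.filter fun i => K i = K t).card = 2) {π π' : PairPartition k}
    (hπ : ∀ t, K (π.r t) = K (π.s t)) (hπ' : ∀ t, K (π'.r t) = K (π'.s t)) : π = π' := by
  have hrange : ∀ π : PairPartition k, (∀ t, K (π.r t) = K (π.s t)) →
      Set.range π.r = {i | ∀ j, K j = K i → i ≤ j} := by
    intro π hπ
    ext i
    constructor
    · rintro ⟨t, rfl⟩ j hj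
      rcases mem_pair_of_card_fiber_eq_two (h _) (π.r_ne_s t) (hπ t).symm hj with rfl | rfl
      · exact le_rfl
      · exact (π.r_lt_s t).le
    · intro hi
      rcases π.block_spec i with h' | h'
      · exact ⟨_, h'.symm⟩
      · have := hi (π.r (π.block i)) (by rw [hπ, ← h'])
        have h2 := π.r_lt_s (π.block i)
        rw [← h'] at h2
        exact absurd this (not_le.2 h2)
  have hr : π.r = π'.r :=
    (π.r_strictMono.range_inj π'.r_strictMono).1 ((hrange π hπ).trans (hrange π' hπ').symm)
  refine PairPartition.ext hr (funext fun t => ?_)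
  have hne : π.r t ≠ π'.s t := by
    rw [hr]
    exact π'.r_ne_s t
  have hK : K (π'.s t) = K (π.r t) := by rw [hr, hπ']
  rcases mem_pair_of_card_fiber_eq_two (h (π.r t)) hne hK (hπ t).symm with h' | h'
  · exact absurd h'.symm (π.r_ne_s t)
  · exact h'

/-- The Gaussian-type pairing sum: only pairings that match equal keys contribute. -/
noncomputable def wickSum {k : ℕ} (K : Fin (2 * k) → κ) (c : Fin (2 * k) → Fin (2 * k) → ℂ) : ℂ :=
  ∑ π : PairPartition k, ∏ t, if K (π.r t) = K (π.s t) then c (π.r t) (π.s t) else 0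

lemma wickSum_eq_zero {k : ℕ} {K : Fin (2 * k) → κ} (c : Fin (2 * k) → Fin (2 * k) → ℂ)
    (h : ∃ t, ∀ s, K s = K t → s = t) : wickSum K c = 0 := by
  obtain ⟨i, hi⟩ := h
  refine Finset.sum_eq_zero fun π _ => Finset.prod_eq_zero (Finset.mem_univ (π.block i)) ?_
  rw [if_neg]
  intro hK
  have hne := π.r_ne_s (π.block i)
  rcases π.block_spec i with h' | h'
  · rw [← h'] at hK hne
    exact hne (hi _ hK.symm).symm
  · rw [← h'] at hK hne
    exact hne (hi _ hK)

lemma wickSum_eq_prod {k : ℕ} {K : Fin (2 * k) → κ} (c : Fin (2 * k) → Fin (2 * k) → ℂ)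
    (h : ∀ t, (Finset.univ.filter fun i => K i = K t).card = 2) {π : PairPartition k}
    (hπ : ∀ t, K (π.r t) = K (π.s t)) : wickSum K c = ∏ t, c (π.r t) (π.s t) := by
  rw [wickSum, Finset.sum_eq_single π]
  · exact Finset.prod_congr rfl fun t _ => if_pos (hπ t)
  · intro π' _ hne
    have : ¬ ∀ t, K (π'.r t) = K (π'.s t) := fun h' => hne (pairPartition_unique h h' hπ)
    push Not at this
    obtain ⟨t, ht⟩ := this
    exact Finset.prod_eq_zero (Finset.mem_univ t) (if_neg ht)
  · simp

lemma norm_wickSum_le {k : ℕ} (K : Fin (2 * k) → κ) {c : Fin (2 * k) → Fin (2 * k) → ℂ} {C : ℝ}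
    (hc : ∀ i j, ‖c i j‖ ≤ C) (hC : 0 ≤ C) :
    ‖wickSum K c‖ ≤ Fintype.card (PairPartition k) * C ^ k := by
  refine (norm_sum_le _ _).trans ?_
  have : ∀ π ∈ (Finset.univ : Finset (PairPartition k)),
      ‖∏ t, if K (π.r t) = K (π.s t) then c (π.r t) (π.s t) else 0‖ ≤ C ^ k := by
    intro π _
    rw [norm_prod]
    calc _ ≤ ∏ _t : Fin k, C := by
          refine Finset.prod_le_prod (fun _ _ => norm_nonneg _) fun t _ => ?_
          split_ifs
          · exact hc _ _
          · simpa using hC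
      _ = C ^ k := by simp
  simpa using Finset.sum_le_sum this

end Fibers

/-! ### Expectations of products of independent inputs -/

section Independence

variable {κ Ω E : Type*} [DecidableEq κ] [MeasurableSpace Ω] {P : Measure Ω}
  [MeasurableSpace E] {Z : κ → Ω → E}

/-- Grouping the factors by key leaves functions of distinct, hence independent, variables. -/
lemma integral_prod_eq_prod_fibers (hZ : iIndepFun Z P) (mZ : ∀ b, Measurable (Z b)) {p : ℕ}
    {F : Fin p → E → ℂ} (mF : ∀ t, Measurable (F t)) (K : Fin p → κ) :
    ∫ ω, ∏ t, F t (Z (K t) ω) ∂P =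
      ∏ b ∈ Finset.univ.image K, ∫ ω, ∏ t with K t = b, F t (Z b ω) ∂P := by
  have h1 : iIndepFun (fun b : Finset.univ.image K => Z b) P := hZ.precomp Subtype.val_injective
  have h2 := h1.integral_fun_prod_comp (𝕜 := ℂ)
    (f := fun (b : Finset.univ.image K) (e : E) => ∏ t with K t = (b : κ), F t e)
    (fun b => (mZ b).aemeasurable)
    (fun b => (Finset.measurable_fun_prod _ fun t _ => mF t).aestronglyMeasurable)
  rw [Finset.prod_coe_sort (Finset.univ.image K)
    (fun b => ∫ ω, ∏ t with K t = b, F t (Z b ω) ∂P)] at h2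
  rw [← h2]
  congr 1
  ext ω
  rw [Finset.prod_coe_sort (Finset.univ.image K) (fun b => ∏ t with K t = b, F t (Z b ω)),
    ← Finset.prod_fiberwise_of_maps_to (s := Finset.univ) (t := Finset.univ.image K) (g := K)
      (fun t _ => Finset.mem_image_of_mem _ (Finset.mem_univ t))]
  refine Finset.prod_congr rfl fun b _ => Finset.prod_congr rfl fun t ht => ?_
  rw [(Finset.mem_filter.1 ht).2]

lemma integral_prod_eq_zero_of_single (hZ : iIndepFun Z P) (mZ : ∀ b, Measurable (Z b)) {p : ℕ}
    {F : Fin p → E → ℂ} (mF : ∀ t, Measurable (F t)) {K : Fin p → κ}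
    (hF : ∀ t b, ∫ ω, F t (Z b ω) ∂P = 0) (h : ∃ t, ∀ s, K s = K t → s = t) :
    ∫ ω, ∏ t, F t (Z (K t) ω) ∂P = 0 := by
  obtain ⟨t, ht⟩ := h
  rw [integral_prod_eq_prod_fibers hZ mZ mF]
  refine Finset.prod_eq_zero (Finset.mem_image_of_mem K (Finset.mem_univ t)) ?_
  have : (Finset.univ.filter fun s => K s = K t) = {t} := by
    ext s
    simp only [Finset.mem_filter, Finset.mem_univ, true_and, Finset.mem_singleton]
    exact ⟨ht s, fun h => by rw [h]⟩
  simp_rw [this, Finset.prod_singleton]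
  exact hF t _

lemma integral_prod_eq_prod_pairs (hZ : iIndepFun Z P) (mZ : ∀ b, Measurable (Z b)) {k : ℕ}
    {F : Fin (2 * k) → E → ℂ} (mF : ∀ t, Measurable (F t)) {K : Fin (2 * k) → κ}
    (h : ∀ t, (Finset.univ.filter fun i => K i = K t).card = 2) {π : PairPartition k}
    (hπ : ∀ t, K (π.r t) = K (π.s t)) :
    ∫ ω, ∏ t, F t (Z (K t) ω) ∂P =
      ∏ t, ∫ ω, F (π.r t) (Z (K (π.r t)) ω) * F (π.s t) (Z (K (π.r t)) ω) ∂P := by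
  rw [integral_prod_eq_prod_fibers hZ mZ mF]
  symm
  refine Finset.prod_bij (fun t _ => K (π.r t)) ?_ ?_ ?_ ?_
  · exact fun t _ => Finset.mem_image_of_mem _ (Finset.mem_univ _)
  · intro t _ t' _ htt
    rcases mem_pair_of_card_fiber_eq_two (h _) (π.r_ne_s t) (hπ t).symm htt.symm with h' | h'
    · exact (π.r_strictMono.injective h').symm
    · have := congrArg π.block h'
      simpa using this.symm
  · intro b hb
    obtain ⟨i, -, rfl⟩ := Finset.mem_image.1 hb
    refine ⟨π.block i, Finset.mem_univ _, ?_⟩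
    rcases π.block_spec i with h' | h'
    · rw [← h']
    · rw [hπ, ← h']
  · intro t _
    have : (Finset.univ.filter fun i => K i = K (π.r t)) = {π.r t, π.s t} := by
      ext i
      simp only [Finset.mem_filter, Finset.mem_univ, true_and, Finset.mem_insert,
        Finset.mem_singleton]
      refine ⟨mem_pair_of_card_fiber_eq_two (h _) (π.r_ne_s t) (hπ t).symm, ?_⟩
      rintro (rfl | rfl)
      · rfl
      · exact (hπ t).symm
    simp_rw [this, Finset.prod_pair (π.r_ne_s t)]

end Independence

/-! ### Covariances and moments of the entries -/

/-- The entry `a ^ ε` (for `c = true`) or `b ^ ε` (for `c = false`) of an input pair `(a, b)`. -/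
noncomputable def entry (ε : StarExp) (c : Bool) (e : ℂ × ℂ) : ℂ :=
  ε.app (if c then e.1 else e.2)

/-- The covariance of two entries that use the same input pair. -/
noncomputable def entryCov (ρ : Correlations) (ε : StarExp) (c : Bool) (ε' : StarExp) (c' : Bool) :
    ℂ :=
  match c, c' with
  | true, true => (((ε.sign : ℂ) * 2 * Complex.I * (ρ.ρ₁ : ℂ)) ^ kron ε ε')
  | false, false => (((ε.sign : ℂ) * 2 * Complex.I * (ρ.ρ₅ : ℂ)) ^ kron ε ε')
  | true, false => mixedCoeff ρ ε.sign (kron ε ε')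
  | false, true => mixedCoeff ρ ε'.sign (kron ε ε')

lemma measurable_entry (ε : StarExp) (c : Bool) : Measurable (entry ε c) := by
  have hs : Measurable (star : ℂ → ℂ) := continuous_star.measurable
  cases ε <;> cases c
  · exact measurable_snd
  · exact measurable_fst
  · exact hs.comp measurable_snd
  · exact hs.comp measurable_fst

lemma norm_entry (ε : StarExp) (c : Bool) (e : ℂ × ℂ) :
    ‖entry ε c e‖ = ‖if c then e.1 else e.2‖ := by
  cases ε <;> simp [entry, StarExp.app]

lemma entry_toComplex {Ω : Type*} (ε : StarExp) (c : Bool) (x y u v : Ω → ℝ) (ω : Ω) :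
    entry ε c (toComplex x y ω, toComplex u v ω) =
      ((if c then x ω else u ω : ℝ) : ℂ) +
        (ε.sign : ℂ) * Complex.I * ((if c then y ω else v ω : ℝ) : ℂ) := by
  cases ε <;> cases c <;> simp [entry, StarExp.app, StarExp.sign, toComplex]

section RealMoments

variable {Ω : Type*} [MeasurableSpace Ω] {P : Measure Ω}

lemma integrable_mul_of_sq {f g : Ω → ℝ} (mf : Measurable f) (mg : Measurable g)
    (hf : Integrable (fun ω => |f ω| ^ 2) P) (hg : Integrable (fun ω => |g ω| ^ 2) P) :
    Integrable (fun ω => f ω * g ω) P := by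
  refine (hf.add hg).mono' (mf.mul mg).aestronglyMeasurable (ae_of_all _ fun ω => ?_)
  simp only [Pi.add_apply, Real.norm_eq_abs, abs_mul]
  nlinarith [sq_nonneg (|f ω| - |g ω|), sq_nonneg (|f ω| + |g ω|)]

/-- Every entry has the form p + s i q with s the sign of its exponent, so one expansion serves all
combinations of types and exponents. -/
lemma integral_mul_affine {p q p' q' : Ω → ℝ} (s s' : ℂ)
    (h₁ : Integrable (fun ω => p ω * p' ω) P) (h₂ : Integrable (fun ω => q ω * q' ω) P)
    (h₃ : Integrable (fun ω => p ω * q' ω) P) (h₄ : Integrable (fun ω => q ω * p' ω) P) :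
    ∫ ω, ((p ω : ℂ) + s * Complex.I * (q ω : ℂ)) * ((p' ω : ℂ) + s' * Complex.I * (q' ω : ℂ)) ∂P =
      ((∫ ω, p ω * p' ω ∂P : ℝ) : ℂ) - s * s' * ((∫ ω, q ω * q' ω ∂P : ℝ) : ℂ) +
        Complex.I * (s' * ((∫ ω, p ω * q' ω ∂P : ℝ) : ℂ) + s * ((∫ ω, q ω * p' ω ∂P : ℝ) : ℂ)) := by
  have e : ∀ ω, ((p ω : ℂ) + s * Complex.I * (q ω : ℂ)) *
      ((p' ω : ℂ) + s' * Complex.I * (q' ω : ℂ)) =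
      ((p ω * p' ω : ℝ) : ℂ) + (-(s * s')) * ((q ω * q' ω : ℝ) : ℂ) +
        ((Complex.I * s') * ((p ω * q' ω : ℝ) : ℂ) + (Complex.I * s) * ((q ω * p' ω : ℝ) : ℂ)) := by
    intro ω
    push_cast
    linear_combination (s * s' * q ω * q' ω : ℂ) * Complex.I_sq
  simp_rw [e]
  have i₁ := h₁.ofReal (𝕜 := ℂ)
  have i₂ := (h₂.ofReal (𝕜 := ℂ)).const_mul (-(s * s'))
  have i₃ := (h₃.ofReal (𝕜 := ℂ)).const_mul (Complex.I * s')
  have i₄ := (h₄.ofReal (𝕜 := ℂ)).const_mul (Complex.I * s)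
  refine (integral_add (i₁.add i₂) (i₃.add i₄)).trans ?_
  refine (congrArg₂ (· + ·) (integral_add i₁ i₂) (integral_add i₃ i₄)).trans ?_
  simp_rw [integral_const_mul]
  simp only [Complex.coe_algebraMap] at *
  rw [integral_complex_ofReal, integral_complex_ofReal, integral_complex_ofReal,
    integral_complex_ofReal]
  ring

end RealMoments

namespace InputAssumption

variable {Ω : ℕ → Type*} [∀ n, MeasurableSpace (Ω n)] {P : ∀ n, Measure (Ω n)}
  {ρ : Correlations} {x y u v : ∀ n, ℤ → Ω n → ℝ}

lemma measurable_pair (h : InputAssumption P ρ x y u v) (n : ℕ) (j : ℤ) :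
    Measurable fun ω => (toComplex (x n j) (y n j) ω, toComplex (u n j) (v n j) ω) := by
  have h1 := h.measurable_x n j
  have h2 := h.measurable_y n j
  have h3 := h.measurable_u n j
  have h4 := h.measurable_v n j
  unfold toComplex
  fun_prop

lemma integral_entry (h : InputAssumption P ρ x y u v) (n : ℕ) (ε : StarExp) (c : Bool) (j : ℤ) :
    ∫ ω, entry ε c (toComplex (x n j) (y n j) ω, toComplex (u n j) (v n j) ω) ∂P n = 0 := by
  cases ε <;> cases c <;> simp only [entry, StarExp.app, if_true, Bool.false_eq_true, if_false]
  · exact h.mean_b n j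
  · exact h.mean_a n j
  · exact (integral_conj).trans (by rw [h.mean_b n j, map_zero])
  · exact (integral_conj).trans (by rw [h.mean_a n j, map_zero])

lemma integral_entry_mul_entry (h : InputAssumption P ρ x y u v) (n : ℕ) (ε ε' : StarExp)
    (c c' : Bool) (j : ℤ) :
    ∫ ω, entry ε c (toComplex (x n j) (y n j) ω, toComplex (u n j) (v n j) ω) *
      entry ε' c' (toComplex (x n j) (y n j) ω, toComplex (u n j) (v n j) ω) ∂P n =
      entryCov ρ ε c ε' c' := by
  obtain ⟨C, hC⟩ := h.moments
  obtain ⟨⟨ix, -⟩, ⟨iy, -⟩, ⟨iu, -⟩, ⟨iv, -⟩⟩ := hC 2 (by norm_num) n j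
  have mx := h.measurable_x n j
  have my := h.measurable_y n j
  have mu := h.measurable_u n j
  have mv := h.measurable_v n j
  -- Variance one, split equally between the real and imaginary parts, leaves 1/2 for each.
  have hx : ∫ ω, x n j ω * x n j ω ∂P n = 1 / 2 ∧ ∫ ω, y n j ω * y n j ω ∂P n = 1 / 2 := by
    have h1 := h.variance_a n j
    have h2 := h.balanced_a n j
    have e : ∀ ω, ‖toComplex (x n j) (y n j) ω‖ ^ 2 = x n j ω ^ 2 + y n j ω ^ 2 := by
      intro ω
      rw [← Complex.normSq_eq_norm_sq, toComplex, mul_comm, Complex.normSq_add_mul_I]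
    simp_rw [sq_abs] at ix iy
    simp_rw [e] at h1
    rw [integral_add ix iy] at h1
    simp_rw [← pow_two]
    constructor <;> linarith
  have hu : ∫ ω, u n j ω * u n j ω ∂P n = 1 / 2 ∧ ∫ ω, v n j ω * v n j ω ∂P n = 1 / 2 := by
    have h1 := h.variance_b n j
    have h2 := h.balanced_b n j
    have e : ∀ ω, ‖toComplex (u n j) (v n j) ω‖ ^ 2 = u n j ω ^ 2 + v n j ω ^ 2 := by
      intro ω
      rw [← Complex.normSq_eq_norm_sq, toComplex, mul_comm, Complex.normSq_add_mul_I]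
    simp_rw [sq_abs] at iu iv
    simp_rw [e] at h1
    rw [integral_add iu iv] at h1
    simp_rw [← pow_two]
    constructor <;> linarith
  have comm : ∀ f g : Ω n → ℝ, ∫ ω, f ω * g ω ∂P n = ∫ ω, g ω * f ω ∂P n :=
    fun f g => integral_congr_ae (ae_of_all _ fun ω => mul_comm _ _)
  have c1 := h.corr₁ n j
  have c2 := h.corr₂ n j
  have c3 := h.corr₃ n j
  have c4 := h.corr₄ n j
  have c5 := h.corr₅ n j
  have c6 := h.corr₆ n j
  have c1' := (comm _ _).trans c1
  have c2' := (comm _ _).trans c2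
  have c3' := (comm _ _).trans c3
  have c4' := (comm _ _).trans c4
  have c5' := (comm _ _).trans c5
  have c6' := (comm _ _).trans c6
  simp_rw [entry_toComplex]
  cases c <;> cases c' <;> simp only [if_true, Bool.false_eq_true, if_false]
  · rw [integral_mul_affine _ _ (integrable_mul_of_sq mu mu iu iu)
      (integrable_mul_of_sq mv mv iv iv) (integrable_mul_of_sq mu mv iu iv)
      (integrable_mul_of_sq mv mu iv iu), hu.1, hu.2, c5, c5']
    cases ε <;> cases ε' <;> simp [entryCov, StarExp.sign, kron] <;> ring
  · rw [integral_mul_affine _ _ (integrable_mul_of_sq mu mx iu ix)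
      (integrable_mul_of_sq mv my iv iy) (integrable_mul_of_sq mu my iu iy)
      (integrable_mul_of_sq mv mx iv ix), c2', c6', c4, c3']
    cases ε <;> cases ε' <;> simp [entryCov, mixedCoeff, StarExp.sign, kron] <;> ring
  · rw [integral_mul_affine _ _ (integrable_mul_of_sq mx mu ix iu)
      (integrable_mul_of_sq my mv iy iv) (integrable_mul_of_sq mx mv ix iv)
      (integrable_mul_of_sq my mu iy iu), c2, c6, c3, c4']
    cases ε <;> cases ε' <;> simp [entryCov, mixedCoeff, StarExp.sign, kron] <;> ring
  · rw [integral_mul_affine _ _ (integrable_mul_of_sq mx mx ix ix)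
      (integrable_mul_of_sq my my iy iy) (integrable_mul_of_sq mx my ix iy)
      (integrable_mul_of_sq my mx iy ix), hx.1, hx.2, c1, c1']
    cases ε <;> cases ε' <;> simp [entryCov, StarExp.sign, kron] <;> ring

lemma exists_moment_bound (h : InputAssumption P ρ x y u v) {q : ℕ} (hq : 1 ≤ q) :
    ∃ C : ℝ, ∀ n ε c j,
      Integrable (fun ω => ‖entry ε c (toComplex (x n j) (y n j) ω,
        toComplex (u n j) (v n j) ω)‖ ^ q) (P n) ∧
      ∫ ω, ‖entry ε c (toComplex (x n j) (y n j) ω,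
        toComplex (u n j) (v n j) ω)‖ ^ q ∂P n ≤ C := by
  obtain ⟨C, hC⟩ := h.moments
  -- The constant comes from the convexity bound (s + t)^q ≤ 2^(q-1) (s^q + t^q).
  refine ⟨2 ^ (q - 1) * (C q + C q), fun n ε c j => ?_⟩
  have key : ∀ {f g : Ω n → ℝ}, Measurable f → Measurable g →
      (Integrable (fun ω => |f ω| ^ q) (P n) ∧ ∫ ω, |f ω| ^ q ∂(P n) ≤ C q) →
      (Integrable (fun ω => |g ω| ^ q) (P n) ∧ ∫ ω, |g ω| ^ q ∂(P n) ≤ C q) →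
      Integrable (fun ω => ‖toComplex f g ω‖ ^ q) (P n) ∧
        ∫ ω, ‖toComplex f g ω‖ ^ q ∂(P n) ≤ 2 ^ (q - 1) * (C q + C q) := by
    intro f g mf mg hf hg
    have hle : ∀ ω, ‖toComplex f g ω‖ ^ q ≤ 2 ^ (q - 1) * (|f ω| ^ q + |g ω| ^ q) := by
      intro ω
      have h1 : ‖toComplex f g ω‖ ≤ |f ω| + |g ω| := by
        refine (norm_add_le _ _).trans (le_of_eq ?_)
        simp
      exact (pow_le_pow_left₀ (norm_nonneg _) h1 q).trans
        (add_pow_le (abs_nonneg _) (abs_nonneg _) q)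
    have hi := (hf.1.add hg.1).const_mul (2 ^ (q - 1) : ℝ)
    have hi' : Integrable (fun ω => ‖toComplex f g ω‖ ^ q) (P n) := by
      refine hi.mono' ?_ (ae_of_all _ fun ω => ?_)
      · unfold toComplex
        exact Measurable.aestronglyMeasurable (by fun_prop)
      · rw [Real.norm_of_nonneg (by positivity)]
        exact hle ω
    refine ⟨hi', (integral_mono hi' hi hle).trans ?_⟩
    rw [integral_const_mul]
    refine mul_le_mul_of_nonneg_left ?_ (by positivity)
    exact (integral_add hf.1 hg.1).le.trans (add_le_add hf.2 hg.2)
  obtain ⟨hx, hy, hu, hv⟩ := hC q hq n j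
  simp_rw [norm_entry]
  cases c
  · exact key (h.measurable_u n j) (h.measurable_v n j) hu hv
  · exact key (h.measurable_x n j) (h.measurable_y n j) hx hy

end InputAssumption

/-! ### Uniform bounds for products -/

section ProductBound

variable {Ω : Type*} [MeasurableSpace Ω] {P : Measure Ω}

/-- The product is at most the p-th power of its largest factor; this replaces Hölder's inequality.
-/
lemma prod_le_sum_pow {p : ℕ} (hp : 1 ≤ p) (f : Fin p → ℝ) (hf : ∀ t, 0 ≤ f t) :
    ∏ t, f t ≤ ∑ t, f t ^ p := by
  have : Nonempty (Fin p) := ⟨⟨0, hp⟩⟩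
  obtain ⟨t₀, ht₀⟩ := Finite.exists_max f
  calc ∏ t, f t ≤ ∏ _t : Fin p, f t₀ :=
        Finset.prod_le_prod (fun t _ => hf t) fun t _ => ht₀ t
    _ = f t₀ ^ p := by simp
    _ ≤ ∑ t, f t ^ p :=
        Finset.single_le_sum (f := fun t => f t ^ p) (fun t _ => pow_nonneg (hf t) p)
          (Finset.mem_univ t₀)

/-- The summand 1 is needed only for p = 0, where the product is 1. -/
lemma integrable_prod_and_bound [IsProbabilityMeasure P] {p : ℕ} {f : Fin p → Ω → ℂ}
    (mf : ∀ t, Measurable (f t)) {C : ℝ}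
    (h : ∀ t, Integrable (fun ω => ‖f t ω‖ ^ p) P ∧ ∫ ω, ‖f t ω‖ ^ p ∂P ≤ C) :
    Integrable (fun ω => ∏ t, f t ω) P ∧ ‖∫ ω, ∏ t, f t ω ∂P‖ ≤ 1 + p * C := by
  rcases Nat.eq_zero_or_pos p with rfl | hp
  · simp
  have hi : Integrable (fun ω => ∑ t, ‖f t ω‖ ^ p) P :=
    integrable_finsetSum _ fun t _ => (h t).1
  have hle : ∀ ω, ‖∏ t, f t ω‖ ≤ ∑ t, ‖f t ω‖ ^ p := fun ω => by
    rw [norm_prod]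
    exact prod_le_sum_pow hp _ fun t => norm_nonneg _
  refine ⟨hi.mono' (Finset.measurable_fun_prod _ fun t _ => mf t).aestronglyMeasurable
    (ae_of_all _ hle), ?_⟩
  refine (norm_integral_le_of_norm_le hi (ae_of_all _ hle)).trans ?_
  rw [integral_finsetSum _ fun t _ => (h t).1]
  refine (Finset.sum_le_sum fun t _ => (h t).2).trans ?_
  simp

end ProductBound

/-! ### Traces as sums over closed paths -/

section TraceExpansion

lemma list_prod_apply {n p : ℕ} (A : Fin p → Matrix (Fin n) (Fin n) ℂ) (i j : Fin n) :
    (List.ofFn A).prod i j = ∑ w : Fin (p + 1) → Fin n,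
      if w 0 = i ∧ w (Fin.last p) = j then ∏ t : Fin p, A t (w t.castSucc) (w t.succ) else 0 := by
  induction p generalizing i with
  | zero =>
    rw [← (Equiv.funUnique (Fin 1) (Fin n)).symm.sum_comp]
    simp only [List.ofFn_zero, List.prod_nil, Matrix.one_apply, Finset.univ_eq_empty,
      Finset.prod_empty]
    have : ∀ x : Fin n, (Equiv.funUnique (Fin 1) (Fin n)).symm x 0 = x := fun x => rfl
    have h' : ∀ x : Fin n, (Equiv.funUnique (Fin 1) (Fin n)).symm x (Fin.last 0) = x :=
      fun x => rfl
    simp_rw [this, h', ite_and]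
    simp
  | succ p ih =>
    rw [List.ofFn_succ, List.prod_cons, Matrix.mul_apply,
      ← (Fin.consEquiv (fun _ : Fin (p + 2) => Fin n)).sum_comp, Fintype.sum_prod_type]
    have e : ∀ (x : Fin n) (w : Fin (p + 1) → Fin n),
        (if (Fin.consEquiv fun _ : Fin (p + 2) => Fin n) (x, w) 0 = i ∧
            (Fin.consEquiv fun _ : Fin (p + 2) => Fin n) (x, w) (Fin.last (p + 1)) = j then
          ∏ t : Fin (p + 1), A t ((Fin.consEquiv fun _ : Fin (p + 2) => Fin n) (x, w) t.castSucc)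
            ((Fin.consEquiv fun _ : Fin (p + 2) => Fin n) (x, w) t.succ) else 0) =
        if x = i then (if w (Fin.last p) = j then
          A 0 i (w 0) * ∏ t : Fin p, A t.succ (w t.castSucc) (w t.succ) else 0) else 0 := by
      intro x w
      rw [ite_and]
      simp only [Fin.consEquiv_apply, Fin.cons_zero, ← Fin.succ_last, Fin.cons_succ]
      split_ifs with h1 h2
      · rw [Fin.prod_univ_succ]
        subst h1
        simp
      · rfl
      · rfl
    simp_rw [e, Finset.sum_ite_irrel, Finset.sum_const_zero, Finset.sum_ite_eq',
      Finset.mem_univ, if_true, ih, Finset.mul_sum]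
    rw [Finset.sum_comm]
    refine Finset.sum_congr rfl fun w _ => ?_
    simp_rw [ite_and, mul_ite, mul_zero]
    simp

/-- The closed index paths of length `p` in `Fin n`. -/
def closedPaths (n p : ℕ) : Finset (Fin (p + 1) → Fin n) :=
  Finset.univ.filter fun w => w 0 = w (Fin.last p)

lemma trace_list_prod {n p : ℕ} (A : Fin p → Matrix (Fin n) (Fin n) ℂ) :
    (List.ofFn A).prod.trace =
      ∑ w ∈ closedPaths n p, ∏ t : Fin p, A t (w t.castSucc) (w t.succ) := by
  simp_rw [Matrix.trace, Matrix.diag_apply, list_prod_apply]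
  rw [Finset.sum_comm, closedPaths, Finset.sum_filter]
  refine Finset.sum_congr rfl fun w _ => ?_
  simp_rw [ite_and]
  simp [eq_comm]

end TraceExpansion

/-- The index `n + 1 - i - j` (for indices starting from `1`) of the input in position `(i, j)` of
a Hankel matrix. -/
def hankelIndex {n : ℕ} (i j : Fin n) : ℤ := (n : ℤ) - 1 - i - j

/-- Whether the entry in position `(i, j)` of `H ^ ε` is an `a`-entry. -/
def isLower {n : ℕ} (ε : StarExp) (i j : Fin n) : Bool :=
  match ε with
  | .one => decide (j < i)
  | .star => decide (i < j)

/-- Reversing the rows carries the antidiagonal that separates a from b in `genToeplitz` to the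
diagonal, which itself belongs to b. -/
lemma hankel_apply {n : ℕ} (a b : ℤ → ℂ) (i j : Fin n) :
    hankel n a b i j = if j < i then a (hankelIndex i j) else b (hankelIndex i j) := by
  have h1 : hankel n a b i j = genToeplitz n a b (Fin.rev i) j := by
    simp [hankel, backwardIdentity, Matrix.mul_apply]
  have h2 : ((Fin.rev i).val : ℤ) - (j.val : ℤ) = hankelIndex i j := by
    have := i.isLt
    simp only [hankelIndex, Fin.val_rev]
    omega
  rw [h1, genToeplitz, Matrix.of_apply, h2]
  refine if_congr ?_ rfl rfl
  have := i.isLt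
  rw [Fin.lt_def, Fin.val_rev]
  omega

/-- The input index is symmetric in i and j, so taking adjoints only conjugates the entries and
exchanges the two sides of the diagonal. -/
lemma app_hankel_apply {n : ℕ} (ε : StarExp) (a b : ℤ → ℂ) (i j : Fin n) :
    (ε.app (hankel n a b)) i j =
      entry ε (isLower ε i j) (a (hankelIndex i j), b (hankelIndex i j)) := by
  cases ε
  · simp [StarExp.app, hankel_apply, entry, isLower]
  · have : hankelIndex j i = hankelIndex i j := by
      simp only [hankelIndex]
      ring
    simp only [StarExp.app, Matrix.star_apply, hankel_apply, entry, isLower, this,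
      decide_eq_true_eq]

/-- The entry that a path picks from the `t`-th factor of a word. -/
noncomputable def pathEntry {n p : ℕ} (ε : Fin p → StarExp) (w : Fin (p + 1) → Fin n) (t : Fin p) :
    ℂ × ℂ → ℂ :=
  entry (ε t) (isLower (ε t) (w t.castSucc) (w t.succ))

/-- The index of the input pair that a path picks from the `t`-th factor of a word. -/
def pathKey {n p m : ℕ} (τ : Fin p → Fin m) (w : Fin (p + 1) → Fin n) (t : Fin p) : Fin m × ℤ :=
  (τ t, hankelIndex (w t.castSucc) (w t.succ))

lemma trace_starWord {n p m : ℕ} (τ : Fin p → Fin m) (ε : Fin p → StarExp) (c : ℝ)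
    (Z : Fin m × ℤ → ℂ × ℂ) :
    (starWord (fun i => (c : ℂ) • hankel n (fun j => (Z (i, j)).1) (fun j => (Z (i, j)).2))
      τ ε).trace =
      (c : ℂ) ^ p * ∑ w ∈ closedPaths n p, ∏ t, pathEntry ε w t (Z (pathKey τ w t)) := by
  rw [starWord, trace_list_prod, Finset.mul_sum]
  refine Finset.sum_congr rfl fun w _ => ?_
  have hc : ∀ (η : StarExp) (M : Matrix (Fin n) (Fin n) ℂ) (i j : Fin n),
      (η.app ((c : ℂ) • M)) i j = c * (η.app M) i j := by
    intro η M i j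
    cases η <;> simp [StarExp.app]
  simp_rw [hc, app_hankel_apply, Finset.prod_mul_distrib]
  simp [pathEntry, pathKey]

lemma expTrace_starWord {Ω : Type*} [MeasurableSpace Ω] {P : Measure Ω} {n p m : ℕ}
    (τ : Fin p → Fin m) (ε : Fin p → StarExp) (c : ℝ) (Z : Fin m × ℤ → Ω → ℂ × ℂ)
    (hZ : ∀ w ∈ closedPaths n p,
      Integrable (fun ω => ∏ t, pathEntry ε w t (Z (pathKey τ w t) ω)) P) :
    expTrace P (fun ω => starWord
      (fun i => (c : ℂ) • hankel n (fun j => (Z (i, j) ω).1) (fun j => (Z (i, j) ω).2)) τ ε) =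
      (n : ℂ)⁻¹ * (c : ℂ) ^ p *
        ∑ w ∈ closedPaths n p, ∫ ω, ∏ t, pathEntry ε w t (Z (pathKey τ w t) ω) ∂P := by
  have e := fun ω => trace_starWord (n := n) τ ε c (fun b => Z b ω)
  rw [expTrace]
  simp_rw [e]
  rw [integral_const_mul, integral_finsetSum _ hZ, mul_assoc]

/-! ### Degenerate paths are negligible -/

section Counting

lemma path_ext {n p : ℕ} {w w' : Fin (p + 1) → Fin n} (hlast : w (Fin.last p) = w' (Fin.last p))
    (h : ∀ t : Fin p, hankelIndex (w t.castSucc) (w t.succ) =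
      hankelIndex (w' t.castSucc) (w' t.succ)) : w = w' := by
  funext i
  induction i using Fin.reverseInduction with
  | last => exact hlast
  | cast i ih =>
    have := h i
    rw [ih] at this
    simp only [hankelIndex] at this
    apply Fin.ext
    omega

lemma hankelIndex_mem {n : ℕ} (i j : Fin n) :
    hankelIndex i j ∈ Finset.Icc (-(n : ℤ)) n := by
  have := i.isLt
  have := j.isLt
  rw [Finset.mem_Icc, hankelIndex]
  constructor <;> omega

/-- The closed paths that use fewer than `p / 2` input pairs. -/
def degeneratePaths (n : ℕ) {p m : ℕ} (τ : Fin p → Fin m) : Finset (Fin (p + 1) → Fin n) :=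
  (closedPaths n p).filter fun w => 2 * (Finset.univ.image (pathKey τ w)).card < p

/-- The factors count the end point, a set of B indices inside [-n, n], and a sequence of length p
in that set; these data determine the path by `path_ext`. The second hypothesis allows a smaller
index set to be enlarged to exactly B elements. -/
lemma card_degeneratePaths_le {n p m B : ℕ} (τ : Fin p → Fin m) (hB : p ≤ 2 * B + 2)
    (hBn : B ≤ 2 * n + 1) :
    (degeneratePaths n τ).card ≤ n * ((2 * n + 1) ^ B * B ^ p) := by
  classical
  set S : Finset (Fin p → ℤ) := (Finset.powersetCard B (Finset.Icc (-(n : ℤ)) n)).biUnion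
    fun s => Fintype.piFinset fun _ => s with hS
  have hIcc : (Finset.Icc (-(n : ℤ)) n).card = 2 * n + 1 := by
    rw [Int.card_Icc]
    omega
  have hScard : S.card ≤ (2 * n + 1) ^ B * B ^ p := by
    refine (Finset.card_biUnion_le_card_mul _ _ (B ^ p) fun s hs => ?_).trans ?_
    · rw [Fintype.card_piFinset_const, (Finset.mem_powersetCard.1 hs).2]
    · rw [Finset.card_powersetCard, hIcc]
      exact Nat.mul_le_mul_right _ (Nat.choose_le_pow _ _)
  have hle : (degeneratePaths n τ).card ≤ ((Finset.univ : Finset (Fin n)) ×ˢ S).card := by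
    refine Finset.card_le_card_of_injOn
      (fun w => (w (Fin.last p), fun t => hankelIndex (w t.castSucc) (w t.succ))) ?_ ?_
    · intro w hw
      have hw2 := (Finset.mem_filter.1 hw).2
      set I := Finset.univ.image fun t : Fin p => hankelIndex (w t.castSucc) (w t.succ) with hI
      have hI1 : I.card ≤ B := by
        have : I = (Finset.univ.image (pathKey τ w)).image Prod.snd := by
          rw [Finset.image_image]
          rfl
        have h2 : I.card ≤ (Finset.univ.image (pathKey τ w)).card := by
          rw [this]
          exact Finset.card_image_le
        omega
      have hI2 : I ⊆ Finset.Icc (-(n : ℤ)) n := by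
        intro z hz
        obtain ⟨t, -, rfl⟩ := Finset.mem_image.1 hz
        exact hankelIndex_mem _ _
      obtain ⟨s, hs1, hs2, hs3⟩ :=
        Finset.exists_subsuperset_card_eq hI2 hI1 (by rw [hIcc]; exact hBn)
      simp only [Finset.coe_product, Set.mem_prod, Finset.mem_coe, Finset.mem_univ, true_and, hS,
        Finset.mem_biUnion]
      refine ⟨s, Finset.mem_powersetCard.2 ⟨hs2, hs3⟩, Fintype.mem_piFinset.2 fun t => hs1 ?_⟩
      exact Finset.mem_image_of_mem _ (Finset.mem_univ t)
    · intro w _ w' _ heq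
      simp only [Prod.mk.injEq] at heq
      exact path_ext heq.1 fun t => congrFun heq.2 t
  refine hle.trans ?_
  rw [Finset.card_product, Finset.card_univ, Fintype.card_fin]
  exact Nat.mul_le_mul_left _ hScard

lemma tendsto_degenerate {p m : ℕ} (τ : Fin p → Fin m) (D : ∀ n, (Fin (p + 1) → Fin n) → ℂ) {C : ℝ}
    (hC : ∀ n w, ‖D n w‖ ≤ C)
    (hD : ∀ n, ∀ w ∈ closedPaths n p, w ∉ degeneratePaths n τ → D n w = 0) :
    Tendsto (fun n : ℕ => (n : ℂ)⁻¹ * (((Real.sqrt n)⁻¹ : ℝ) : ℂ) ^ p *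
      ∑ w ∈ closedPaths n p, D n w) atTop (𝓝 0) := by
  rcases Nat.eq_zero_or_pos p with rfl | hp
  · refine tendsto_const_nhds.congr fun n => ?_
    rw [Finset.sum_eq_zero, mul_zero]
    intro w hw
    refine hD n w hw fun h => ?_
    have := (Finset.mem_filter.1 h).2
    omega
  have hC0 : 0 ≤ C := (norm_nonneg _).trans (hC 1 0)
  -- B is the largest integer with 2B < p. The first inequality bounds the number of keys; the
  -- second leaves a factor n^(-1/2) to spare.
  obtain ⟨B, hB1, hB2⟩ : ∃ B, p ≤ 2 * B + 2 ∧ 2 * B + 1 ≤ p := ⟨(p - 1) / 2, by omega, by omega⟩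
  have hlim : Tendsto (fun n : ℕ => (3 ^ B * B ^ p * C) * (Real.sqrt n)⁻¹) atTop (𝓝 0) := by
    have : Tendsto (fun n : ℕ => (Real.sqrt n)⁻¹) atTop (𝓝 0) :=
      tendsto_inv_atTop_zero.comp (Real.tendsto_sqrt_atTop.comp tendsto_natCast_atTop_atTop)
    simpa using this.const_mul (3 ^ B * B ^ p * C)
  refine squeeze_zero_norm' ?_ hlim
  filter_upwards [eventually_ge_atTop 1, eventually_ge_atTop B] with n hn hnB
  have hsum : ∑ w ∈ closedPaths n p, D n w = ∑ w ∈ degeneratePaths n τ, D n w :=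
    (Finset.sum_subset (Finset.filter_subset _ _) fun w hw hw' => hD n w hw hw').symm
  have hn' : (1 : ℝ) ≤ n := by exact_mod_cast hn
  set s := Real.sqrt n with hs
  have hs1 : 1 ≤ s := Real.one_le_sqrt.2 hn'
  have hs0 : 0 < s := by linarith
  have hsn : s ^ 2 = n := Real.sq_sqrt (by positivity)
  have h1 : ‖∑ w ∈ degeneratePaths n τ, D n w‖ ≤ s ^ 2 * ((3 * s ^ 2) ^ B * B ^ p) * C := by
    refine (norm_sum_le_of_le _ fun w _ => hC n w).trans ?_
    rw [Finset.sum_const, nsmul_eq_mul]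
    refine mul_le_mul_of_nonneg_right ?_ hC0
    calc ((degeneratePaths n τ).card : ℝ) ≤ ((n * ((2 * n + 1) ^ B * B ^ p) : ℕ) : ℝ) := by
          exact_mod_cast card_degeneratePaths_le τ hB1 (by omega)
      _ ≤ _ := by
          push_cast
          rw [hsn]
          gcongr
          linarith
  rw [hsum, norm_mul, norm_mul, norm_pow, norm_inv, Complex.norm_natCast, Complex.norm_real,
    norm_inv, Real.norm_of_nonneg hs0.le]
  calc (n : ℝ)⁻¹ * s⁻¹ ^ p * ‖∑ w ∈ degeneratePaths n τ, D n w‖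
      ≤ (n : ℝ)⁻¹ * s⁻¹ ^ (2 * B + 1) * (s ^ 2 * ((3 * s ^ 2) ^ B * B ^ p) * C) := by
        gcongr ?_ * ?_ * ?_
        exact pow_le_pow_of_le_one (by positivity) (inv_le_one_of_one_le₀ hs1) hB2
    _ = (3 ^ B * B ^ p * C) * s⁻¹ := by
        rw [← hsn, mul_pow, ← pow_mul, inv_pow]
        field_simp
        ring

end Counting

/-! ### Matched paths as lattice points -/

section LatticePaths

variable {k : ℕ} (π : PairPartition k) (ε : Fin (2 * k) → StarExp)

/-- The lattice path with end point `q` and increments `J` on the blocks of `π`, after the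
reflection of every other vertex. -/
noncomputable def latticePos (q : ℤ) (J : Fin k → ℤ) (j : ℕ) : ℤ :=
  q + ∑ ℓ : Fin (2 * k) with j ≤ ℓ.val, nu ℓ * J (π.block ℓ)

/-- The lattice version of `pathPoint`. -/
noncomputable def latticePoint (n : ℕ) (q : ℤ) (J : Fin k → ℤ) (t : Fin (2 * k)) : ℤ :=
  if (ε t).sign * nu t = 1 then latticePos π q J (t.val + 1)
  else (n : ℤ) - 1 - latticePos π q J (t.val + 1)

/-- The lattice version of `indA`. -/
noncomputable def latticeA (n : ℕ) (q : ℤ) (J : Fin k → ℤ) (t : Fin (2 * k)) : ℂ :=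
  if 0 ≤ latticePoint π ε n q J t ∧ 0 ≤ latticePoint π ε n q J t + (ε t).sign * J (π.block t) ∧
    0 ≤ (n : ℤ) - 2 - (2 * latticePoint π ε n q J t + (ε t).sign * J (π.block t)) then 1 else 0

/-- The lattice version of `indB`. -/
noncomputable def latticeB (n : ℕ) (q : ℤ) (J : Fin k → ℤ) (t : Fin (2 * k)) : ℂ :=
  if 0 ≤ (n : ℤ) - 1 - latticePoint π ε n q J t ∧
    0 ≤ (n : ℤ) - 1 - (latticePoint π ε n q J t + (ε t).sign * J (π.block t)) ∧
    0 ≤ 2 * latticePoint π ε n q J t + (ε t).sign * J (π.block t) - ((n : ℤ) - 1) then 1 else 0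

/-- The covariance of the entries in positions `r` and `s` in terms of their types. -/
noncomputable def covForm (ρ : Correlations) (ε : Fin (2 * k) → StarExp) (r s : Fin (2 * k))
    (αr βr αs βs : ℂ) : ℂ :=
  entryCov ρ (ε r) true (ε s) true * (αr * αs) + entryCov ρ (ε r) false (ε s) false * (βr * βs) +
    entryCov ρ (ε r) true (ε s) false * (αr * βs) + entryCov ρ (ε r) false (ε s) true * (βr * αs)

/-- The contribution of the lattice path with data `q`, `J`. -/
noncomputable def latticeWeight (ρ : Correlations) (n : ℕ) (q : ℤ) (J : Fin k → ℤ) : ℂ :=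
  if ∑ ℓ, nu ℓ * J (π.block ℓ) = 0 then
    ∏ t, covForm ρ ε (π.r t) (π.s t) (latticeA π ε n q J (π.r t)) (latticeB π ε n q J (π.r t))
      (latticeA π ε n q J (π.s t)) (latticeB π ε n q J (π.s t))
  else 0

lemma latticePos_zero (q : ℤ) (J : Fin k → ℤ) :
    latticePos π q J 0 = q + ∑ ℓ, nu ℓ * J (π.block ℓ) := by
  simp [latticePos]

lemma latticePos_last (q : ℤ) (J : Fin k → ℤ) : latticePos π q J (2 * k) = q := by
  rw [latticePos, Finset.filter_false_of_mem]
  · simp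
  · intro ℓ _
    have := ℓ.isLt
    omega

lemma latticePos_step (q : ℤ) (J : Fin k → ℤ) (t : Fin (2 * k)) :
    latticePos π q J t.val = latticePos π q J (t.val + 1) + nu t * J (π.block t) := by
  have : (Finset.univ.filter fun ℓ : Fin (2 * k) => t.val ≤ ℓ.val) =
      insert t (Finset.univ.filter fun ℓ : Fin (2 * k) => t.val + 1 ≤ ℓ.val) := by
    ext ℓ
    simp only [Finset.mem_filter, Finset.mem_univ, true_and, Finset.mem_insert, Fin.ext_iff]
    omega
  rw [latticePos, latticePos, this, Finset.sum_insert (by simp)]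
  ring

/-- Reflection of `{0, …, n - 1}` at odd times. -/
def reflectOdd (n : ℕ) (j : ℕ) (z : ℤ) : ℤ := if Even j then z else (n : ℤ) - 1 - z

/-- The index fixes the sum of two consecutive vertices. Reflecting the one at an odd time turns the
sum into a difference, whose sign alternates with the parity of the step. -/
lemma latticePos_eq_reflectOdd {n : ℕ} {w : Fin (2 * k + 1) → Fin n} {J : Fin k → ℤ}
    (hJ : ∀ t : Fin (2 * k), hankelIndex (w t.castSucc) (w t.succ) = J (π.block t))
    (j : Fin (2 * k + 1)) :
    latticePos π (w (Fin.last (2 * k))) J j = reflectOdd n j (w j) := by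
  induction j using Fin.reverseInduction with
  | last =>
    rw [Fin.val_last, latticePos_last, reflectOdd, if_pos (by simp)]
  | cast t ih =>
    rw [Fin.val_castSucc, latticePos_step]
    rw [Fin.val_succ] at ih
    rw [ih, ← hJ t]
    simp only [reflectOdd, nu, hankelIndex]
    by_cases h : Even t.val
    · have h' : ¬ Even (t.val + 1) := by simpa [Nat.even_add_one] using h
      rw [if_neg h', if_neg h', if_pos h]
      ring
    · have h' : Even (t.val + 1) := by simpa [Nat.even_add_one] using h
      rw [if_pos h', if_pos h', if_neg h]
      ring

lemma sign_eq_one_or (η : StarExp) : η.sign = 1 ∨ η.sign = -1 := by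
  cases η <;> simp [StarExp.sign]

lemma nu_eq_one_or (t : Fin (2 * k)) : nu t = 1 ∨ nu t = -1 := by
  unfold nu
  split_ifs <;> simp

/-- Let r and c be the vertices before and after the step. The lattice point and its sum with the
signed increment are c and n - 1 - r for exponent 1, and n - 1 - c and r for `*`. The last
inequality of `latticeA` is then the strict comparison in `isLower`, and that of `latticeB` is its
negation. -/
lemma lattice_indicators {n : ℕ} {w : Fin (2 * k + 1) → Fin n} {J : Fin k → ℤ}
    (hJ : ∀ t : Fin (2 * k), hankelIndex (w t.castSucc) (w t.succ) = J (π.block t))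
    (t : Fin (2 * k)) :
    latticeA π ε n (w (Fin.last (2 * k))) J t =
        (if isLower (ε t) (w t.castSucc) (w t.succ) then 1 else 0) ∧
      latticeB π ε n (w (Fin.last (2 * k))) J t =
        (if isLower (ε t) (w t.castSucc) (w t.succ) then 0 else 1) := by
  have h1 := (w t.castSucc).isLt
  have h2 := (w t.succ).isLt
  have hp := latticePos_eq_reflectOdd π hJ t.succ
  rw [Fin.val_succ] at hp
  have hpt : latticePoint π ε n (w (Fin.last (2 * k))) J t =
      if ε t = .one then ((w t.succ : ℕ) : ℤ) else (n : ℤ) - 1 - (w t.succ : ℕ) := by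
    rw [latticePoint, hp, reflectOdd, nu]
    by_cases h : Even (t.val + 1) <;> cases ε t <;> simp [h, StarExp.sign]
  rw [latticeA, latticeB, hpt, ← hJ t, hankelIndex]
  cases hε : ε t
  · simp only [StarExp.sign, isLower, decide_eq_true_eq, if_true, Fin.lt_def]
    constructor
    · refine if_congr ?_ rfl rfl
      omega
    · rw [← ite_not]
      refine if_congr ?_ rfl rfl
      omega
  · simp only [StarExp.sign, isLower, decide_eq_true_eq, Fin.lt_def, reduceCtorEq, if_false]
    constructor
    · refine if_congr ?_ rfl rfl
      omega
    · rw [← ite_not]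
      refine if_congr ?_ rfl rfl
      omega

/-- Let U be the lattice point and V its sum with the signed increment. `latticeA` requires U, V ≥ 0
and U + V ≤ n - 2; `latticeB` requires U, V ≤ n - 1 and U + V ≥ n - 1. Either confines V to [0, n),
and V is the earlier position up to reflection. -/
lemma latticePos_mem_of_ne_zero {n : ℕ} {q : ℤ} {J : Fin k → ℤ} {t : Fin (2 * k)}
    (h : latticeA π ε n q J t ≠ 0 ∨ latticeB π ε n q J t ≠ 0) :
    0 ≤ latticePos π q J t.val ∧ latticePos π q J t.val < n := by
  have hpt : latticePoint π ε n q J t + (ε t).sign * J (π.block t) =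
      if (ε t).sign * nu t = 1 then latticePos π q J t.val
      else (n : ℤ) - 1 - latticePos π q J t.val := by
    rw [latticePoint, latticePos_step]
    rcases sign_eq_one_or (ε t) with h1 | h1 <;> rcases nu_eq_one_or t with h2 | h2 <;>
      simp [h1, h2] <;> ring
  have hrow : 0 ≤ latticePoint π ε n q J t + (ε t).sign * J (π.block t) ∧
      latticePoint π ε n q J t + (ε t).sign * J (π.block t) < n := by
    rcases h with h | h
    · rw [latticeA] at h
      have := of_not_not fun hn => h (if_neg hn)
      omega
    · rw [latticeB] at h
      have := of_not_not fun hn => h (if_neg hn)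
      omega
  rw [hpt] at hrow
  split_ifs at hrow <;> omega

lemma covForm_ind (ρ : Correlations) (r s : Fin (2 * k)) (c c' : Bool) :
    covForm ρ ε r s (if c then 1 else 0) (if c then 0 else 1) (if c' then 1 else 0)
      (if c' then 0 else 1) = entryCov ρ (ε r) c (ε s) c' := by
  cases c <;> cases c' <;> simp [covForm]

lemma ne_zero_of_covForm {ρ : Correlations} {r s : Fin (2 * k)} {αr βr αs βs : ℂ}
    (h : covForm ρ ε r s αr βr αs βs ≠ 0) : (αr ≠ 0 ∨ βr ≠ 0) ∧ (αs ≠ 0 ∨ βs ≠ 0) := by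
  constructor
  · by_contra! h'
    exact h (by simp [covForm, h'.1, h'.2])
  · by_contra! h'
    exact h (by simp [covForm, h'.1, h'.2])

/-- A nonzero product forces a nonzero indicator at every step, so all positions are in range and
undoing the reflection yields the path. -/
lemma exists_path_of_latticeWeight_ne_zero {ρ : Correlations} {n : ℕ} {q : ℤ} {J : Fin k → ℤ}
    (hq : 0 ≤ q ∧ q < n) (h : latticeWeight π ε ρ n q J ≠ 0) :
    ∃ w ∈ closedPaths n (2 * k), (w (Fin.last (2 * k)) : ℤ) = q ∧
      ∀ t : Fin (2 * k), hankelIndex (w t.castSucc) (w t.succ) = J (π.block t) := by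
  rw [latticeWeight] at h
  have hclosed : ∑ ℓ, nu ℓ * J (π.block ℓ) = 0 := of_not_not fun hn => h (if_neg hn)
  rw [if_pos hclosed] at h
  have hstep : ∀ t : Fin (2 * k), latticeA π ε n q J t ≠ 0 ∨ latticeB π ε n q J t ≠ 0 := by
    intro t
    have h1 := ne_zero_of_covForm ε (Finset.prod_ne_zero_iff.1 h (π.block t) (Finset.mem_univ _))
    rcases π.block_spec t with h2 | h2
    · rw [← h2] at h1
      exact h1.1
    · rw [← h2] at h1
      exact h1.2
  have hpos : ∀ j : Fin (2 * k + 1), 0 ≤ latticePos π q J j ∧ latticePos π q J j < n := by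
    intro j
    induction j using Fin.lastCases with
    | last => simpa [latticePos_last] using hq
    | cast t => exact latticePos_mem_of_ne_zero π ε (hstep t)
  have hrefl : ∀ j : Fin (2 * k + 1), 0 ≤ reflectOdd n j (latticePos π q J j) ∧
      reflectOdd n j (latticePos π q J j) < n := by
    intro j
    have := hpos j
    rw [reflectOdd]
    split_ifs <;> omega
  let w : Fin (2 * k + 1) → Fin n := fun j =>
    ⟨(reflectOdd n j (latticePos π q J j)).toNat, by have := hrefl j; omega⟩
  have hw : ∀ j, ((w j : ℕ) : ℤ) = reflectOdd n j (latticePos π q J j) := fun j =>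
    Int.toNat_of_nonneg (hrefl j).1
  have hlast : ((w (Fin.last (2 * k)) : ℕ) : ℤ) = q := by
    rw [hw, Fin.val_last, latticePos_last, reflectOdd, if_pos (by simp)]
  refine ⟨w, ?_, hlast, ?_⟩
  · rw [closedPaths, Finset.mem_filter]
    refine ⟨Finset.mem_univ _, Fin.ext ?_⟩
    have h0 : ((w 0 : ℕ) : ℤ) = q := by
      rw [hw, Fin.val_zero, latticePos_zero, hclosed, reflectOdd, if_pos (by simp), add_zero]
    omega
  · intro t
    rw [hankelIndex, hw, hw, Fin.val_castSucc, Fin.val_succ, latticePos_step]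
    simp only [reflectOdd, nu]
    by_cases h : Even t.val
    · have h' : ¬ Even (t.val + 1) := by simpa [Nat.even_add_one] using h
      rw [if_neg h', if_neg h', if_pos h]
      ring
    · have h' : Even (t.val + 1) := by simpa [Nat.even_add_one] using h
      rw [if_pos h', if_pos h', if_neg h]
      ring

/-- The matched closed paths are parametrized by their end point and one increment per block. -/
lemma sum_matched_paths (ρ : Correlations) (n : ℕ) :
    ∑ w ∈ closedPaths n (2 * k), ∏ t,
      (if hankelIndex (w (π.r t).castSucc) (w (π.r t).succ) =
          hankelIndex (w (π.s t).castSucc) (w (π.s t).succ) then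
        entryCov ρ (ε (π.r t)) (isLower (ε (π.r t)) (w (π.r t).castSucc) (w (π.r t).succ))
          (ε (π.s t)) (isLower (ε (π.s t)) (w (π.s t).castSucc) (w (π.s t).succ))
        else 0) =
      ∑ q ∈ Finset.Ico (0 : ℤ) n, ∑ J ∈ Fintype.piFinset fun _ : Fin k => Finset.Ico (-(n : ℤ)) n,
        latticeWeight π ε ρ n q J := by
  simp_rw [Finset.prod_ite_zero, Finset.mem_univ, true_imp_iff]
  rw [← Finset.sum_filter, ← Finset.sum_product']
  have hJ : ∀ w : Fin (2 * k + 1) → Fin n,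
      (∀ t, hankelIndex (w (π.r t).castSucc) (w (π.r t).succ) =
          hankelIndex (w (π.s t).castSucc) (w (π.s t).succ)) →
      ∀ t : Fin (2 * k), hankelIndex (w t.castSucc) (w t.succ) =
        hankelIndex (w (π.r (π.block t)).castSucc) (w (π.r (π.block t)).succ) := by
    intro w hw t
    rcases π.block_spec t with h | h
    · rw [← h]
    · rw [hw, ← h]
  refine Finset.sum_of_injOn (fun w => ((w (Fin.last (2 * k)) : ℤ),
    fun t => hankelIndex (w (π.r t).castSucc) (w (π.r t).succ))) ?_ ?_ ?_ ?_
  · intro w hw w' hw' heq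
    simp only [Finset.coe_filter, Set.mem_ofPred_eq] at hw hw'
    simp only [Prod.mk.injEq] at heq
    refine path_ext (Fin.ext (by exact_mod_cast heq.1)) fun t => ?_
    rw [hJ w hw.2, hJ w' hw'.2]
    exact congrFun heq.2 _
  · intro w _
    simp only [Finset.coe_product, Set.mem_prod, Finset.mem_coe, Finset.mem_Ico,
      Fintype.mem_piFinset, hankelIndex]
    refine ⟨by omega, fun t => ?_⟩
    have := (w (π.r t).castSucc).isLt
    have := (w (π.r t).succ).isLt
    omega
  · rintro ⟨q, J⟩ hx hnot
    simp only [Finset.mem_product, Finset.mem_Ico] at hx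
    by_contra h
    obtain ⟨w, hw, hq, hwJ⟩ := exists_path_of_latticeWeight_ne_zero π ε hx.1 h
    refine hnot ⟨w, ?_, ?_⟩
    · rw [Finset.coe_filter]
      refine ⟨hw, fun t => ?_⟩
      rw [hwJ, hwJ, π.block_r, π.block_s]
    · simp [hq, hwJ]
  · intro w hw
    rw [Finset.mem_filter] at hw
    have hwJ := hJ w hw.2
    set J : Fin k → ℤ := fun t => hankelIndex (w (π.r t).castSucc) (w (π.r t).succ) with hJdef
    have hclosed : ∑ ℓ, nu ℓ * J (π.block ℓ) = 0 := by
      have h0 := latticePos_eq_reflectOdd π (J := J) hwJ 0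
      rw [Fin.val_zero, latticePos_zero, reflectOdd, if_pos (by simp),
        (Finset.mem_filter.1 hw.1).2] at h0
      linarith
    rw [latticeWeight, if_pos hclosed]
    refine Finset.prod_congr rfl fun t _ => ?_
    rw [(lattice_indicators π ε (J := J) hwJ (π.r t)).1,
      (lattice_indicators π ε (J := J) hwJ (π.r t)).2,
      (lattice_indicators π ε (J := J) hwJ (π.s t)).1,
      (lattice_indicators π ε (J := J) hwJ (π.s t)).2, covForm_ind]

end LatticePaths

/-! ### Lattice sums as integrals of step functions -/

section RiemannSums

lemma setIntegral_comp_of_fibers {α β : Type*} [MeasurableSpace α] {μ : Measure α} {s : Set α}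
    {g : α → β} {T : Finset β} (hT : ∀ z ∈ s, g z ∈ T)
    (hm : ∀ b ∈ T, MeasurableSet (s ∩ g ⁻¹' {b})) {c : ℝ} (hc0 : 0 ≤ c)
    (hc : ∀ b ∈ T, μ (s ∩ g ⁻¹' {b}) = ENNReal.ofReal c) (f : β → ℂ) :
    ∫ z in s, f (g z) ∂μ = (c : ℂ) * ∑ b ∈ T, f b := by
  have hs : s = ⋃ b ∈ T, s ∩ g ⁻¹' {b} := by
    ext z
    simp only [Set.mem_iUnion, Set.mem_inter_iff, Set.mem_preimage, Set.mem_singleton_iff,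
      exists_prop]
    exact ⟨fun hz => ⟨g z, hT z hz, hz, rfl⟩, fun ⟨_, _, hz, _⟩ => hz⟩
  have hcongr : ∀ b ∈ T, Set.EqOn (fun z => f (g z)) (fun _ => f b) (s ∩ g ⁻¹' {b}) := by
    intro b _ z hz
    have : g z = b := hz.2
    simp only [this]
  rw [hs, integral_biUnion_finset T hm, Finset.mul_sum]
  · refine Finset.sum_congr rfl fun b hb => ?_
    rw [setIntegral_congr_fun (hm b hb) (hcongr b hb), setIntegral_const, Measure.real, hc b hb,
      ENNReal.toReal_ofReal hc0]
    simp
  · intro b _ b' _ hbb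
    refine Set.disjoint_left.2 fun z hz hz' => hbb ?_
    have h1 : g z = b := hz.2
    have h2 : g z = b' := hz'.2
    exact h1.symm.trans h2
  · intro b hb
    refine (integrableOn_congr_fun (hcongr b hb) (hm b hb)).2 ?_
    exact integrableOn_const (by rw [hc b hb]; exact ENNReal.ofReal_ne_top)

lemma floor_mul_eq_iff {n : ℕ} (hn : 1 ≤ n) (z : ℝ) (j : ℤ) :
    ⌊(n : ℝ) * z⌋ = j ↔ z ∈ Set.Ico ((j : ℝ) / n) ((j + 1) / n) := by
  have hn' : (0 : ℝ) < n := by exact_mod_cast hn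
  rw [Int.floor_eq_iff, Set.mem_Ico, div_le_iff₀ hn', lt_div_iff₀ hn', mul_comm]

lemma floor_mul_mem_Ico {n : ℕ} {z : ℝ} {a b : ℤ} (hn : 1 ≤ n) (hz : z ∈ Set.Ico (a : ℝ) b) :
    ⌊(n : ℝ) * z⌋ ∈ Finset.Ico (a * n) (b * n) := by
  have hn' : (0 : ℝ) < n := by exact_mod_cast hn
  rw [Finset.mem_Ico, Int.le_floor, Int.floor_lt]
  push_cast
  constructor
  · nlinarith [hz.1]
  · nlinarith [hz.2]

lemma mem_Ico_of_floor_mul {n : ℕ} {z : ℝ} {a b : ℤ} (hn : 1 ≤ n)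
    (hz : ⌊(n : ℝ) * z⌋ ∈ Finset.Ico (a * n) (b * n)) : z ∈ Set.Ico (a : ℝ) b := by
  have hn' : (0 : ℝ) < n := by exact_mod_cast hn
  rw [Finset.mem_Ico, Int.le_floor, Int.floor_lt] at hz
  push_cast at hz
  refine ⟨le_of_mul_le_mul_left ?_ hn', lt_of_mul_lt_mul_left ?_ hn'.le⟩
  · linarith [hz.1]
  · linarith [hz.2]

lemma volume_floor_cell {n : ℕ} (hn : 1 ≤ n) (j : ℤ) :
    ((j : ℝ) + 1) / n - (j : ℝ) / n = (n : ℝ)⁻¹ := by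
  have hn' : (n : ℝ) ≠ 0 := by positivity
  field_simp
  ring

lemma integral_floor {n : ℕ} (hn : 1 ≤ n) (f : ℤ → ℂ) :
    ∫ z in Set.Icc (0 : ℝ) 1, f ⌊(n : ℝ) * z⌋ = (n : ℂ)⁻¹ * ∑ q ∈ Finset.Ico (0 : ℤ) n, f q := by
  have hcell : ∀ q ∈ Finset.Ico (0 : ℤ) n,
      Set.Ico (0 : ℝ) 1 ∩ (fun z : ℝ => ⌊(n : ℝ) * z⌋) ⁻¹' {q} =
      Set.Ico ((q : ℝ) / n) ((q + 1) / n) := by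
    intro q hq
    ext z
    rw [Set.mem_inter_iff, Set.mem_preimage, Set.mem_singleton_iff, ← floor_mul_eq_iff hn]
    refine ⟨fun h => h.2, fun h => ⟨?_, h⟩⟩
    have := mem_Ico_of_floor_mul (z := z) (a := 0) (b := 1) hn (by rw [h]; simpa using hq)
    simpa using this
  have := setIntegral_comp_of_fibers (μ := volume) (s := Set.Ico (0 : ℝ) 1)
    (g := fun z : ℝ => ⌊(n : ℝ) * z⌋) (T := Finset.Ico (0 : ℤ) n) (c := (n : ℝ)⁻¹)
    (fun z hz => by
      have := floor_mul_mem_Ico (z := z) (a := 0) (b := 1) hn (by simpa using hz)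
      simpa using this)
    (fun q hq => by rw [hcell q hq]; exact measurableSet_Ico) (by positivity)
    (fun q hq => by rw [hcell q hq, Real.volume_Ico, volume_floor_cell hn]) f
  -- Only the half-open interval is tiled exactly by the cells; the missing end point is null.
  rw [← setIntegral_congr_set Ico_ae_eq_Icc, this]
  push_cast
  rfl

lemma integral_floor_pi {n k : ℕ} (hn : 1 ≤ n) (f : (Fin k → ℤ) → ℂ) :
    ∫ z in Set.Icc (fun _ : Fin k => (-1 : ℝ)) (fun _ => 1), f (fun t => ⌊(n : ℝ) * z t⌋) =
      (n : ℂ)⁻¹ ^ k * ∑ J ∈ Fintype.piFinset fun _ : Fin k => Finset.Ico (-(n : ℤ)) n, f J := by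
  have hcell : ∀ J ∈ Fintype.piFinset fun _ : Fin k => Finset.Ico (-(n : ℤ)) n,
      (Set.univ.pi fun _ : Fin k => Set.Ico (-1 : ℝ) 1) ∩
        (fun (z : Fin k → ℝ) (t : Fin k) => ⌊(n : ℝ) * z t⌋) ⁻¹' {J} =
      Set.univ.pi fun t => Set.Ico ((J t : ℝ) / n) ((J t + 1) / n) := by
    intro J hJ
    rw [Fintype.mem_piFinset] at hJ
    ext z
    simp only [Set.mem_inter_iff, Set.mem_preimage, Set.mem_singleton_iff, Set.mem_univ_pi,
      ← floor_mul_eq_iff hn]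
    refine ⟨fun h t => congrFun h.2 t, fun h => ⟨fun t => ?_, funext h⟩⟩
    have := mem_Ico_of_floor_mul (z := z t) (a := -1) (b := 1) hn
      (by rw [h]; simpa using hJ t)
    simpa using this
  have := setIntegral_comp_of_fibers (μ := (volume : Measure (Fin k → ℝ)))
    (s := Set.univ.pi fun _ : Fin k => Set.Ico (-1 : ℝ) 1)
    (g := fun (z : Fin k → ℝ) (t : Fin k) => ⌊(n : ℝ) * z t⌋)
    (T := Fintype.piFinset fun _ : Fin k => Finset.Ico (-(n : ℤ)) n) (c := (n : ℝ)⁻¹ ^ k)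
    (fun z hz => by
      rw [Fintype.mem_piFinset]
      intro t
      have := floor_mul_mem_Ico (z := z t) (a := -1) (b := 1) hn
        (by simpa using (Set.mem_univ_pi.1 hz) t)
      simpa using this)
    (fun q hq => by
      rw [hcell q hq]
      exact MeasurableSet.univ_pi fun _ => measurableSet_Ico) (by positivity)
    (fun q hq => by
      rw [hcell q hq, Real.volume_pi_Ico]
      simp_rw [volume_floor_cell hn]
      rw [Finset.prod_const, Finset.card_univ, Fintype.card_fin,
        ENNReal.ofReal_pow (by positivity)]) f
  have hae := Measure.univ_pi_Ico_ae_eq_Icc (μ := fun _ : Fin k => (volume : Measure ℝ))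
    (f := fun _ : Fin k => (-1 : ℝ)) (g := fun _ => 1)
  rw [← volume_pi] at hae
  rw [← setIntegral_congr_set hae, this]
  push_cast
  rfl

lemma tendsto_floor_mul_div (z : ℝ) :
    Tendsto (fun n : ℕ => (⌊(n : ℝ) * z⌋ : ℝ) / n) atTop (𝓝 z) := by
  have h1 : Tendsto (fun n : ℕ => z - (n : ℝ)⁻¹) atTop (𝓝 z) := by
    simpa using tendsto_const_nhds.sub (tendsto_inv_atTop_nhds_zero_nat (𝕜 := ℝ))
  refine tendsto_of_tendsto_of_tendsto_of_le_of_le' h1 tendsto_const_nhds ?_ ?_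
  · filter_upwards [eventually_ge_atTop 1] with n hn
    have hn' : (0 : ℝ) < n := by exact_mod_cast hn
    rw [le_div_iff₀ hn', sub_mul, inv_mul_cancel₀ hn'.ne']
    linarith [Int.lt_floor_add_one ((n : ℝ) * z)]
  · filter_upwards [eventually_ge_atTop 1] with n hn
    have hn' : (0 : ℝ) < n := by exact_mod_cast hn
    rw [div_le_iff₀ hn']
    linarith [Int.floor_le ((n : ℝ) * z)]

/-- Away from zero, the sign of the limit is the eventual sign. -/
lemma eventually_nonneg_iff {L : ℕ → ℤ} {l : ℝ}
    (h : Tendsto (fun n : ℕ => (L n : ℝ) / n) atTop (𝓝 l)) (hl : l ≠ 0) :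
    ∀ᶠ n in atTop, (0 ≤ L n ↔ 0 ≤ l) := by
  rcases lt_or_gt_of_ne hl with hl | hl
  · filter_upwards [h.eventually_lt_const hl] with n hn
    refine iff_of_false (fun h0 => ?_) (not_le.2 hl)
    have : (0 : ℝ) ≤ (L n : ℝ) / n := div_nonneg (by exact_mod_cast h0) (Nat.cast_nonneg n)
    linarith
  · filter_upwards [h.eventually_const_lt hl, eventually_ge_atTop 1] with n hn hn1
    refine iff_of_true ?_ hl.le
    have hn' : (0 : ℝ) < n := by exact_mod_cast hn1
    have : (0 : ℝ) < L n := by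
      have := mul_pos hn hn'
      rwa [div_mul_cancel₀ _ hn'.ne'] at this
    exact_mod_cast this.le

end RiemannSums

/-! ### The limit for a fixed pair partition -/

section LatticeLimit

variable {k : ℕ} (π : PairPartition k) (ε : Fin (2 * k) → StarExp)

lemma PairPartition.sum_eq_sum_pairs {M : Type*} [AddCommMonoid M] (f : Fin (2 * k) → M) :
    ∑ ℓ, f ℓ = ∑ t, (f (π.r t) + f (π.s t)) := by
  rw [← Finset.sum_fiberwise (s := Finset.univ) (g := π.block)]
  refine Finset.sum_congr rfl fun t _ => ?_
  have : (Finset.univ.filter fun ℓ => π.block ℓ = t) = {π.r t, π.s t} := by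
    ext ℓ
    simp only [Finset.mem_filter, Finset.mem_univ, true_and, Finset.mem_insert,
      Finset.mem_singleton]
    refine ⟨fun h => h ▸ π.block_spec ℓ, π.block_eq⟩
  rw [this, Finset.sum_pair (π.r_ne_s t)]

/-- A nonzero functional is surjective, so its level sets are null. -/
lemma ae_affine_ne_zero {f : ℝ × (Fin k → ℝ) → ℝ} (L : ℝ × (Fin k → ℝ) →ₗ[ℝ] ℝ) (d : ℝ)
    (hf : ∀ p, f p = L p + d) (hL : L ≠ 0) : ∀ᵐ p, f p ≠ 0 := by
  have : (volume : Measure (ℝ × (Fin k → ℝ))).IsAddHaarMeasure :=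
    inferInstanceAs ((volume : Measure ℝ).prod (volume : Measure (Fin k → ℝ))).IsAddHaarMeasure
  have h := (ae_comp_linearMap_mem_iff L (volume : Measure (ℝ × (Fin k → ℝ)))
    (volume : Measure ℝ) (LinearMap.surjective hL) (s := {-d}ᶜ)
    (measurableSet_singleton _).compl).2 (by
      rw [ae_iff]
      simp)
  filter_upwards [h] with p hp h0
  refine hp ?_
  rw [hf] at h0
  rw [Set.mem_singleton_iff]
  linarith

/-- The linear part of `tailSum`. -/
noncomputable def tailLin (t : Fin (2 * k)) : ℝ × (Fin k → ℝ) →ₗ[ℝ] ℝ :=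
  LinearMap.fst ℝ ℝ (Fin k → ℝ) + ∑ ℓ ∈ Finset.Ioi t,
    (nu ℓ : ℝ) • (LinearMap.proj (π.block ℓ) ∘ₗ LinearMap.snd ℝ ℝ (Fin k → ℝ))

lemma tailLin_apply (t : Fin (2 * k)) (p : ℝ × (Fin k → ℝ)) :
    tailLin π t p = tailSum π p.1 p.2 t := by
  simp [tailLin, tailSum, LinearMap.sum_apply]

/-- `pathPoint` contains z₀ with coefficient ±1, so the linear part is nonzero whenever a is. -/
lemma ae_pathPoint_ne (t : Fin (2 * k)) {a : ℝ} (ha : a ≠ 0) (b d : ℝ) :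
    ∀ᵐ p : ℝ × (Fin k → ℝ), a * pathPoint π ε p.1 p.2 t + b * p.2 (π.block t) + d ≠ 0 := by
  have hne : ∀ c : ℝ, c ≠ 0 → c • tailLin π t +
      b • (LinearMap.proj (π.block t) ∘ₗ LinearMap.snd ℝ ℝ (Fin k → ℝ)) ≠ 0 := by
    intro c hc h0
    have := LinearMap.congr_fun h0 ((1 : ℝ), (0 : Fin k → ℝ))
    simp [tailLin_apply, tailSum] at this
    exact hc this
  unfold pathPoint
  split_ifs
  · refine ae_affine_ne_zero _ d (fun p => ?_) (hne a ha)
    simp [tailLin_apply]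
  · refine ae_affine_ne_zero _ (a + d) (fun p => ?_) (hne (-a) (neg_ne_zero.2 ha))
    simp [tailLin_apply]
    ring

/-- The coefficient of the variable of block t₀ is ±2. -/
lemma ae_closing_ne {t₀ : Fin k} (h : nu (π.r t₀) = nu (π.s t₀)) :
    ∀ᵐ p : ℝ × (Fin k → ℝ), ∑ ℓ, (nu ℓ : ℝ) * p.2 (π.block ℓ) ≠ 0 := by
  refine ae_affine_ne_zero (∑ ℓ, (nu ℓ : ℝ) •
    (LinearMap.proj (π.block ℓ) ∘ₗ LinearMap.snd ℝ ℝ (Fin k → ℝ))) 0 (fun p => ?_) fun h0 => ?_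
  · simp [LinearMap.sum_apply]
  · have := LinearMap.congr_fun h0 ((0 : ℝ), Pi.single t₀ (1 : ℝ))
    simp only [LinearMap.sum_apply, LinearMap.smul_apply, LinearMap.comp_apply,
      LinearMap.snd_apply, LinearMap.proj_apply, LinearMap.zero_apply, smul_eq_mul] at this
    rw [π.sum_eq_sum_pairs, Finset.sum_eq_single t₀] at this
    · simp only [π.block_r, π.block_s, Pi.single_eq_same, mul_one, ← h] at this
      rcases nu_eq_one_or (π.r t₀) with h1 | h1 <;> rw [h1] at this <;> norm_num at this
    · intro t _ ht
      simp [ht]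
    · simp

variable (z₀ : ℝ) (z : Fin k → ℝ)

lemma tendsto_latticePos (t : Fin (2 * k)) :
    Tendsto (fun n : ℕ =>
      (latticePos π ⌊(n : ℝ) * z₀⌋ (fun i => ⌊(n : ℝ) * z i⌋) (t.val + 1) : ℝ) / n)
      atTop (𝓝 (tailSum π z₀ z t)) := by
  have hI : (Finset.univ.filter fun ℓ : Fin (2 * k) => t.val + 1 ≤ ℓ.val) = Finset.Ioi t := by
    ext ℓ
    simp only [Finset.mem_filter, Finset.mem_univ, true_and, Finset.mem_Ioi, Fin.lt_def]
    omega
  have h := (tendsto_floor_mul_div z₀).add (tendsto_finsetSum (Finset.Ioi t)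
    fun ℓ _ => (tendsto_floor_mul_div (z (π.block ℓ))).const_mul (nu ℓ : ℝ))
  refine h.congr fun n => ?_
  rw [latticePos, hI]
  push_cast
  rw [add_div, Finset.sum_div]
  simp_rw [mul_div_assoc]

lemma tendsto_latticePoint (t : Fin (2 * k)) :
    Tendsto (fun n : ℕ =>
      (latticePoint π ε n ⌊(n : ℝ) * z₀⌋ (fun i => ⌊(n : ℝ) * z i⌋) t : ℝ) / n)
      atTop (𝓝 (pathPoint π ε z₀ z t)) := by
  unfold latticePoint pathPoint
  split_ifs
  · exact tendsto_latticePos π z₀ z t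
  · have h1 : Tendsto (fun n : ℕ => 1 - (n : ℝ)⁻¹) atTop (𝓝 1) := by
      simpa using tendsto_const_nhds.sub (tendsto_inv_atTop_nhds_zero_nat (𝕜 := ℝ))
    refine (h1.sub (tendsto_latticePos π z₀ z t)).congr' ?_
    filter_upwards [eventually_ge_atTop 1] with n hn
    have hn' : (n : ℝ) ≠ 0 := by positivity
    push_cast
    field_simp

variable {z₀ z}

/-- The constant d disappears after division by n. This absorbs every discrepancy of one or two
between the lattice inequalities and the limit intervals. -/
lemma eventually_affine_nonneg_iff (t : Fin (2 * k)) (a b c d : ℤ)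
    (h : (a : ℝ) * pathPoint π ε z₀ z t + b * z (π.block t) + c ≠ 0) :
    ∀ᶠ n : ℕ in atTop,
      (0 ≤ a * latticePoint π ε n ⌊(n : ℝ) * z₀⌋ (fun i => ⌊(n : ℝ) * z i⌋) t +
        b * ⌊(n : ℝ) * z (π.block t)⌋ + c * n + d ↔
      0 ≤ (a : ℝ) * pathPoint π ε z₀ z t + b * z (π.block t) + c) := by
  refine eventually_nonneg_iff ?_ h
  have h1 := (((tendsto_latticePoint π ε z₀ z t).const_mul (a : ℝ)).add
    ((tendsto_floor_mul_div (z (π.block t))).const_mul (b : ℝ))).add_const (c : ℝ)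
  have h2 := h1.add ((tendsto_inv_atTop_nhds_zero_nat (𝕜 := ℝ)).const_mul (d : ℝ))
  rw [mul_zero, add_zero] at h2
  refine h2.congr' ?_
  filter_upwards [eventually_ge_atTop 1] with n hn
  have hn' : (n : ℝ) ≠ 0 := by positivity
  push_cast
  field_simp

lemma eventually_latticeA (t : Fin (2 * k)) (h1 : pathPoint π ε z₀ z t ≠ 0)
    (h2 : pathPoint π ε z₀ z t + (ε t).sign * z (π.block t) ≠ 0)
    (h3 : -2 * pathPoint π ε z₀ z t + -(ε t).sign * z (π.block t) + 1 ≠ 0) :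
    ∀ᶠ n : ℕ in atTop, latticeA π ε n ⌊(n : ℝ) * z₀⌋ (fun i => ⌊(n : ℝ) * z i⌋) t =
      indA π ε z₀ z t := by
  have e1 := eventually_affine_nonneg_iff π ε t 1 0 0 0 (by simpa using h1)
  have e2 := eventually_affine_nonneg_iff π ε t 1 (ε t).sign 0 0 (by simpa using h2)
  have e3 := eventually_affine_nonneg_iff π ε t (-2) (-(ε t).sign) 1 (-2) (by simpa using h3)
  filter_upwards [e1, e2, e3] with n e1 e2 e3
  classical
  rw [latticeA, indA, Set.indicator_apply]
  refine if_congr ?_ rfl rfl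
  have e3' : 0 ≤ (n : ℤ) - 2 - (2 * latticePoint π ε n ⌊(n : ℝ) * z₀⌋ (fun i => ⌊(n : ℝ) * z i⌋) t +
      (ε t).sign * ⌊(n : ℝ) * z (π.block t)⌋) ↔
      0 ≤ -2 * latticePoint π ε n ⌊(n : ℝ) * z₀⌋ (fun i => ⌊(n : ℝ) * z i⌋) t +
        -(ε t).sign * ⌊(n : ℝ) * z (π.block t)⌋ + 1 * n + -2 := by
    constructor <;> intro h <;> linarith
  rw [e3', e3]
  simp only [one_mul, zero_mul, add_zero] at e1 e2
  rw [e1, e2, limA, Set.mem_Icc, max_le_iff]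
  push_cast
  constructor
  · rintro ⟨a1, a2, a3⟩
    exact ⟨⟨by linarith, by linarith⟩, by linarith⟩
  · rintro ⟨⟨a1, a2⟩, a3⟩
    exact ⟨by linarith, by linarith, by linarith⟩

lemma eventually_latticeB (t : Fin (2 * k)) (h1 : -pathPoint π ε z₀ z t + 1 ≠ 0)
    (h2 : -pathPoint π ε z₀ z t + -(ε t).sign * z (π.block t) + 1 ≠ 0)
    (h3 : 2 * pathPoint π ε z₀ z t + (ε t).sign * z (π.block t) + -1 ≠ 0) :
    ∀ᶠ n : ℕ in atTop, latticeB π ε n ⌊(n : ℝ) * z₀⌋ (fun i => ⌊(n : ℝ) * z i⌋) t =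
      indB π ε z₀ z t := by
  have e1 := eventually_affine_nonneg_iff π ε t (-1) 0 1 (-1) (by simpa using h1)
  have e2 := eventually_affine_nonneg_iff π ε t (-1) (-(ε t).sign) 1 (-1) (by simpa using h2)
  have e3 := eventually_affine_nonneg_iff π ε t 2 (ε t).sign (-1) 1 (by simpa using h3)
  filter_upwards [e1, e2, e3] with n e1 e2 e3
  classical
  rw [latticeB, indB, Set.indicator_apply]
  refine if_congr ?_ rfl rfl
  set U := latticePoint π ε n ⌊(n : ℝ) * z₀⌋ (fun i => ⌊(n : ℝ) * z i⌋) t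
  set V := ⌊(n : ℝ) * z (π.block t)⌋
  have e1' : 0 ≤ (n : ℤ) - 1 - U ↔ 0 ≤ -1 * U + 0 * V + 1 * n + -1 := by
    constructor <;> intro h <;> linarith
  have e2' : 0 ≤ (n : ℤ) - 1 - (U + (ε t).sign * V) ↔
      0 ≤ -1 * U + -(ε t).sign * V + 1 * n + -1 := by
    constructor <;> intro h <;> linarith
  have e3' : 0 ≤ 2 * U + (ε t).sign * V - ((n : ℤ) - 1) ↔
      0 ≤ 2 * U + (ε t).sign * V + -1 * n + 1 := by
    constructor <;> intro h <;> linarith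
  rw [e1', e2', e3', e1, e2, e3, limB, Set.mem_Icc, le_min_iff]
  push_cast
  constructor
  · rintro ⟨a1, a2, a3⟩
    exact ⟨by linarith, by linarith, by linarith⟩
  · rintro ⟨a1, a2, a3⟩
    exact ⟨by linarith, by linarith, by linarith⟩

lemma hankelE_eq_covForm (ρ : Correlations) (r s : Fin (2 * k)) :
    hankelE ρ π ε r s z₀ z =
      covForm ρ ε r s (indA π ε z₀ z r) (indB π ε z₀ z r) (indA π ε z₀ z s) (indB π ε z₀ z s) *
        (1 - (kron (nu r) (nu s) : ℂ)) := rfl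

lemma eventually_closing_ne (h : ∑ ℓ, (nu ℓ : ℝ) * z (π.block ℓ) ≠ 0) :
    ∀ᶠ n : ℕ in atTop, ∑ ℓ, nu ℓ * ⌊(n : ℝ) * z (π.block ℓ)⌋ ≠ 0 := by
  have h1 : Tendsto (fun n : ℕ => ∑ ℓ, (nu ℓ : ℝ) * ((⌊(n : ℝ) * z (π.block ℓ)⌋ : ℝ) / n)) atTop
      (𝓝 (∑ ℓ, (nu ℓ : ℝ) * z (π.block ℓ))) :=
    tendsto_finsetSum _ fun ℓ _ => (tendsto_floor_mul_div (z (π.block ℓ))).const_mul (nu ℓ : ℝ)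
  filter_upwards [h1.eventually_ne h] with n hn h0
  refine hn ?_
  simp_rw [← mul_div_assoc]
  rw [← Finset.sum_div]
  have : ∑ ℓ, (nu ℓ : ℝ) * (⌊(n : ℝ) * z (π.block ℓ)⌋ : ℝ) = 0 := by exact_mod_cast h0
  rw [this, zero_div]

/-- If some pair has equal parities, the limit has a zero factor and almost every point eventually
violates the closing equation. Otherwise that equation holds identically and the indicators are
eventually constant off the boundary hyperplanes. -/
lemma ae_tendsto_latticeWeight (ρ : Correlations) :
    ∀ᵐ p : ℝ × (Fin k → ℝ), Tendsto
      (fun n : ℕ => latticeWeight π ε ρ n ⌊(n : ℝ) * p.1⌋ (fun t => ⌊(n : ℝ) * p.2 t⌋)) atTop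
      (𝓝 (∏ t, hankelE ρ π ε (π.r t) (π.s t) p.1 p.2)) := by
  by_cases hν : ∃ t, nu (π.r t) = nu (π.s t)
  · obtain ⟨t₀, ht₀⟩ := hν
    filter_upwards [ae_closing_ne π ht₀] with p hp
    have h0 : ∏ t, hankelE ρ π ε (π.r t) (π.s t) p.1 p.2 = 0 := by
      refine Finset.prod_eq_zero (Finset.mem_univ t₀) ?_
      rw [hankelE_eq_covForm, kron, if_pos ht₀]
      simp
    rw [h0]
    refine tendsto_const_nhds.congr' ?_
    filter_upwards [eventually_closing_ne π hp] with n hn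
    rw [latticeWeight, if_neg hn]
  · push Not at hν
    have hA : ∀ᵐ p : ℝ × (Fin k → ℝ), ∀ t, ∀ᶠ n : ℕ in atTop,
        latticeA π ε n ⌊(n : ℝ) * p.1⌋ (fun i => ⌊(n : ℝ) * p.2 i⌋) t = indA π ε p.1 p.2 t := by
      refine ae_all_iff.2 fun t => ?_
      filter_upwards [ae_pathPoint_ne π ε t one_ne_zero 0 0,
        ae_pathPoint_ne π ε t one_ne_zero (ε t).sign 0,
        ae_pathPoint_ne π ε t (by norm_num : (-2 : ℝ) ≠ 0) (-(ε t).sign) 1] with p h1 h2 h3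
      exact eventually_latticeA π ε t (by simpa using h1) (by simpa using h2) h3
    have hB : ∀ᵐ p : ℝ × (Fin k → ℝ), ∀ t, ∀ᶠ n : ℕ in atTop,
        latticeB π ε n ⌊(n : ℝ) * p.1⌋ (fun i => ⌊(n : ℝ) * p.2 i⌋) t = indB π ε p.1 p.2 t := by
      refine ae_all_iff.2 fun t => ?_
      filter_upwards [ae_pathPoint_ne π ε t (by norm_num : (-1 : ℝ) ≠ 0) 0 1,
        ae_pathPoint_ne π ε t (by norm_num : (-1 : ℝ) ≠ 0) (-(ε t).sign) 1,
        ae_pathPoint_ne π ε t (by norm_num : (2 : ℝ) ≠ 0) (ε t).sign (-1)] with p h1 h2 h3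
      exact eventually_latticeB π ε t (by simpa using h1) (by simpa using h2) h3
    filter_upwards [hA, hB] with p hA hB
    refine tendsto_const_nhds.congr' ?_
    filter_upwards [eventually_all.2 hA, eventually_all.2 hB] with n hA hB
    have hclosed : ∑ ℓ, nu ℓ * ⌊(n : ℝ) * p.2 (π.block ℓ)⌋ = 0 := by
      rw [π.sum_eq_sum_pairs]
      refine Finset.sum_eq_zero fun t _ => ?_
      have := hν t
      rw [π.block_r, π.block_s, ← add_mul]
      have : nu (π.r t) + nu (π.s t) = 0 := by
        rcases nu_eq_one_or (π.r t) with h1 | h1 <;> rcases nu_eq_one_or (π.s t) with h2 | h2 <;>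
          rw [h1, h2] at this ⊢ <;> simp at this ⊢
      rw [this, zero_mul]
    rw [latticeWeight, if_pos hclosed]
    refine Finset.prod_congr rfl fun t _ => ?_
    rw [hankelE_eq_covForm, kron, if_neg (hν t), hA, hB, hA, hB]
    simp

lemma exists_entryCov_bound (ρ : Correlations) :
    ∃ C : ℝ, 0 ≤ C ∧ ∀ η c η' c', ‖entryCov ρ η c η' c'‖ ≤ C := by
  have : Finite StarExp := Finite.of_injective (fun η : StarExp => decide (η = .one)) (by
    intro a b
    cases a <;> cases b <;> simp)
  obtain ⟨C, hC⟩ := (Set.finite_range fun x : StarExp × Bool × StarExp × Bool =>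
    ‖entryCov ρ x.1 x.2.1 x.2.2.1 x.2.2.2‖).bddAbove
  have h : ∀ η c η' c', ‖entryCov ρ η c η' c'‖ ≤ C := fun η c η' c' => hC ⟨(η, c, η', c'), rfl⟩
  exact ⟨C, (norm_nonneg _).trans (h .one true .one true), h⟩

lemma norm_latticeWeight_le {ρ : Correlations} {C : ℝ} (hC0 : 0 ≤ C)
    (hC : ∀ η c η' c', ‖entryCov ρ η c η' c'‖ ≤ C) (n : ℕ) (q : ℤ) (J : Fin k → ℤ) :
    ‖latticeWeight π ε ρ n q J‖ ≤ (4 * C) ^ k := by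
  rw [latticeWeight]
  split_ifs
  · rw [norm_prod]
    have hA : ∀ t, ‖latticeA π ε n q J t‖ ≤ 1 := by
      intro t
      rw [latticeA]
      split_ifs <;> simp
    have hB : ∀ t, ‖latticeB π ε n q J t‖ ≤ 1 := by
      intro t
      rw [latticeB]
      split_ifs <;> simp
    have hterm : ∀ {c a b : ℂ}, ‖c‖ ≤ C → ‖a‖ ≤ 1 → ‖b‖ ≤ 1 → ‖c * (a * b)‖ ≤ C := by
      intro c a b hc ha hb
      rw [norm_mul, norm_mul]
      calc ‖c‖ * (‖a‖ * ‖b‖) ≤ C * (1 * 1) := by gcongr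
        _ = C := by ring
    -- `covForm` has four terms, each bounded by C.
    calc _ ≤ ∏ _t : Fin k, (4 * C) := by
          refine Finset.prod_le_prod (fun _ _ => norm_nonneg _) fun t _ => ?_
          refine norm_add₄_le.trans ?_
          linarith [hterm (hC (ε (π.r t)) true (ε (π.s t)) true) (hA (π.r t)) (hA (π.s t)),
            hterm (hC (ε (π.r t)) false (ε (π.s t)) false) (hB (π.r t)) (hB (π.s t)),
            hterm (hC (ε (π.r t)) true (ε (π.s t)) false) (hA (π.r t)) (hB (π.s t)),
            hterm (hC (ε (π.r t)) false (ε (π.s t)) true) (hB (π.r t)) (hA (π.s t))]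
      _ = (4 * C) ^ k := by simp
  · rw [norm_zero]
    positivity

/-- Dominated convergence is applied to the inner and then to the outer integral, with constant
bounds. The integrands depend on the point only through discrete floor values, which makes them
measurable. -/
lemma tendsto_sum_latticeWeight (ρ : Correlations) :
    Tendsto (fun n : ℕ => (n : ℂ)⁻¹ * ((n : ℂ)⁻¹ ^ k * ∑ q ∈ Finset.Ico (0 : ℤ) n,
        ∑ J ∈ Fintype.piFinset fun _ : Fin k => Finset.Ico (-(n : ℤ)) n,
          latticeWeight π ε ρ n q J)) atTop
      (𝓝 (∫ z₀ in Set.Icc (0 : ℝ) 1, ∫ z in Set.Icc (fun _ : Fin k => (-1 : ℝ)) (fun _ => 1),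
        ∏ t : Fin k, hankelE ρ π ε (π.r t) (π.s t) z₀ z)) := by
  obtain ⟨C, hC0, hC⟩ := exists_entryCov_bound ρ
  have hb := norm_latticeWeight_le π ε hC0 hC
  have hfin : volume (Set.Icc (fun _ : Fin k => (-1 : ℝ)) (fun _ => 1)) ≠ ⊤ :=
    isCompact_Icc.measure_ne_top
  have hmain : Tendsto (fun n : ℕ => ∫ z₀ in Set.Icc (0 : ℝ) 1,
      ∫ z in Set.Icc (fun _ : Fin k => (-1 : ℝ)) (fun _ => 1),
        latticeWeight π ε ρ n ⌊(n : ℝ) * z₀⌋ (fun t => ⌊(n : ℝ) * z t⌋)) atTop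
      (𝓝 (∫ z₀ in Set.Icc (0 : ℝ) 1, ∫ z in Set.Icc (fun _ : Fin k => (-1 : ℝ)) (fun _ => 1),
        ∏ t : Fin k, hankelE ρ π ε (π.r t) (π.s t) z₀ z)) := by
    refine tendsto_integral_of_dominated_convergence
      (fun _ => (4 * C) ^ k * volume.real (Set.Icc (fun _ : Fin k => (-1 : ℝ)) (fun _ => 1)))
      (fun n => ?_) (integrable_const _) (fun n => ae_of_all _ fun z₀ => ?_) ?_
    · exact (Measurable.of_discrete (f := fun q : ℤ =>
        ∫ z in Set.Icc (fun _ : Fin k => (-1 : ℝ)) (fun _ => 1),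
          latticeWeight π ε ρ n q (fun t => ⌊(n : ℝ) * z t⌋))).comp
        (Int.measurable_floor.comp (measurable_const_mul (n : ℝ))) |>.aestronglyMeasurable
    · exact norm_setIntegral_le_of_norm_le_const hfin.lt_top fun z _ => hb _ _ _
    · have hae := Measure.ae_ae_of_ae_prod (ae_tendsto_latticeWeight π ε ρ)
      filter_upwards [ae_restrict_of_ae hae] with z₀ hz₀
      refine tendsto_integral_of_dominated_convergence (fun _ => (4 * C) ^ k) (fun n => ?_)
        (integrableOn_const hfin) (fun n => ae_of_all _ fun z => hb _ _ _)
        (ae_restrict_of_ae hz₀)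
      have hm : Measurable fun (z : Fin k → ℝ) (t : Fin k) => ⌊(n : ℝ) * z t⌋ :=
        measurable_pi_lambda _ fun t =>
          Int.measurable_floor.comp ((measurable_const_mul (n : ℝ)).comp (measurable_pi_apply t))
      exact ((Measurable.of_discrete
        (f := fun J : Fin k → ℤ => latticeWeight π ε ρ n ⌊(n : ℝ) * z₀⌋ J)).comp
        hm).aestronglyMeasurable
  refine hmain.congr' ?_
  filter_upwards [eventually_ge_atTop 1] with n hn
  simp_rw [fun z₀ : ℝ => integral_floor_pi (k := k) hn (latticeWeight π ε ρ n ⌊(n : ℝ) * z₀⌋)]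
  rw [integral_floor hn (fun q => (n : ℂ)⁻¹ ^ k *
    ∑ J ∈ Fintype.piFinset fun _ : Fin k => Finset.Ico (-(n : ℤ)) n, latticeWeight π ε ρ n q J),
    ← Finset.mul_sum]

end LatticeLimit

/-! ### The free `*`-algebra -/

section StarPolynomials

/-- The other exponent. -/
def StarExp.flip : StarExp → StarExp
  | .one => .star
  | .star => .one

/-- The noncommutative `*`-polynomials in `m` indeterminates. -/
abbrev StarPoly (m : ℕ) : Type := MonoidAlgebra ℂ (FreeMonoid (Fin m × StarExp))

variable {m : ℕ}

/-- Word reversal with exchange of `1` and `*`, as an anti-homomorphism. -/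
def wordStar : FreeMonoid (Fin m × StarExp) →* (FreeMonoid (Fin m × StarExp))ᵐᵒᵖ :=
  FreeMonoid.lift fun x => MulOpposite.op (FreeMonoid.of (x.1, x.2.flip))

lemma wordStar_wordStar (w : FreeMonoid (Fin m × StarExp)) :
    (wordStar (wordStar w).unop).unop = w := by
  induction w using FreeMonoid.inductionOn' with
  | one => simp
  | of_mul x w ih =>
    rw [map_mul, MulOpposite.unop_mul, map_mul, MulOpposite.unop_mul, ih]
    congr 1
    obtain ⟨i, e⟩ := x
    cases e <;> rfl

/-- The conjugate-linear anti-automorphism of `*`-polynomials. -/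
noncomputable def starPolyHom : StarPoly m →+* (StarPoly m)ᵐᵒᵖ :=
  MonoidAlgebra.liftNCRingHom
    (((algebraMap ℂ (StarPoly m)ᵐᵒᵖ) : ℂ →+* (StarPoly m)ᵐᵒᵖ).comp (starRingEnd ℂ))
    ((MonoidHom.op (MonoidAlgebra.of ℂ (FreeMonoid (Fin m × StarExp)))).comp wordStar)
    (fun c _ => Algebra.commute_algebraMap_left (starRingEnd ℂ c) _)

lemma starPolyHom_single (w : FreeMonoid (Fin m × StarExp)) (c : ℂ) :
    (starPolyHom (MonoidAlgebra.single w c)).unop =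
      MonoidAlgebra.single (wordStar w).unop (star c) := by
  rw [starPolyHom, MonoidAlgebra.liftNCRingHom_single]
  simp

noncomputable instance : StarRing (StarPoly m) where
  star a := (starPolyHom a).unop
  star_involutive a := by
    induction a using MonoidAlgebra.induction_linear with
    | zero => simp
    | add a b ha hb => simp only [map_add, MulOpposite.unop_add, ha, hb]
    | single w c =>
      simp only
      rw [starPolyHom_single, starPolyHom_single, wordStar_wordStar, star_star]
  star_mul a b := by rw [map_mul, MulOpposite.unop_mul]
  star_add a b := by rw [map_add, MulOpposite.unop_add]

lemma starPoly_star_single (w : FreeMonoid (Fin m × StarExp)) (c : ℂ) :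
    star (MonoidAlgebra.single w c : StarPoly m) =
      MonoidAlgebra.single (wordStar w).unop (star c) := starPolyHom_single w c

instance : StarModule ℂ (StarPoly m) where
  star_smul c a := by
    induction a using MonoidAlgebra.induction_linear with
    | zero => simp
    | add a b ha hb => simp only [smul_add, star_add, ha, hb]
    | single w d => simp [starPoly_star_single]

/-- The indeterminates. -/
noncomputable def starPolyVar (i : Fin m) : StarPoly m :=
  MonoidAlgebra.of ℂ _ (FreeMonoid.of (i, .one))

lemma lift_eq_starWord {B : Type*} [Ring B] [StarRing B] (M : Fin m → B)
    (w : FreeMonoid (Fin m × StarExp)) :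
    FreeMonoid.lift (fun x : Fin m × StarExp => x.2.app (M x.1)) w =
      starWord M (fun t => (w.toList.get t).1) (fun t => (w.toList.get t).2) := by
  rw [FreeMonoid.lift_apply, starWord]
  congr 1
  exact List.ext_get (by simp) (by simp)

variable {B : Type*} [Ring B] [StarRing B] [Algebra ℂ B]

/-- Evaluation of `*`-polynomials. -/
noncomputable def starPolyEval (M : Fin m → B) : StarPoly m →ₐ[ℂ] B :=
  MonoidAlgebra.lift ℂ B (FreeMonoid (Fin m × StarExp)) (FreeMonoid.lift fun x => x.2.app (M x.1))

lemma starPolyEval_single (M : Fin m → B) (w : FreeMonoid (Fin m × StarExp)) (c : ℂ) :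
    starPolyEval M (MonoidAlgebra.single w c) =
      c • FreeMonoid.lift (fun x : Fin m × StarExp => x.2.app (M x.1)) w :=
  MonoidAlgebra.lift_single _ _ _

lemma starPolyEval_star [StarModule ℂ B] (M : Fin m → B) (a : StarPoly m) :
    starPolyEval M (star a) = star (starPolyEval M a) := by
  have hw : ∀ w : FreeMonoid (Fin m × StarExp),
      FreeMonoid.lift (fun x : Fin m × StarExp => x.2.app (M x.1)) (wordStar w).unop =
        star (FreeMonoid.lift (fun x : Fin m × StarExp => x.2.app (M x.1)) w) := by
    intro w
    induction w using FreeMonoid.inductionOn' with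
    | one => simp
    | of_mul x w ih =>
      rw [map_mul, MulOpposite.unop_mul, map_mul, map_mul, star_mul, ih]
      congr 1
      obtain ⟨i, e⟩ := x
      cases e <;> simp [wordStar, StarExp.flip, StarExp.app]
  induction a using MonoidAlgebra.induction_linear with
  | zero => simp
  | add a b ha hb => simp only [star_add, map_add, ha, hb]
  | single w c => rw [starPoly_star_single, starPolyEval_single, starPolyEval_single, hw, star_smul]

lemma starPolyEval_var (M : Fin m → B) (i : Fin m) : starPolyEval M (starPolyVar i) = M i := by
  simp [starPolyVar, starPolyEval, StarExp.app]

lemma starPolyEval_starWord [StarModule ℂ B] (M : Fin m → B) {p : ℕ} (τ : Fin p → Fin m)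
    (ε : Fin p → StarExp) : starPolyEval M (starWord starPolyVar τ ε) = starWord M τ ε := by
  rw [starWord, map_list_prod, List.map_ofFn, starWord]
  congr 2
  funext t
  cases h : ε t <;> simp [StarExp.app, h, starPolyEval_star, starPolyEval_var]

end StarPolynomials

/-! ### Realizing limit moments by a state -/

section LimitState

lemma trace_mul_star_eq {n : ℕ} (X : Matrix (Fin n) (Fin n) ℂ) :
    (X * star X).trace = ((∑ i, ∑ j, ‖X i j‖ ^ 2 : ℝ) : ℂ) := by
  simp [Matrix.trace, Matrix.mul_apply, Complex.mul_conj, Complex.normSq_eq_norm_sq]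

lemma expTrace_mul_star {Ω : Type*} [MeasurableSpace Ω] (P : Measure Ω) {n : ℕ}
    (X : Ω → Matrix (Fin n) (Fin n) ℂ) :
    0 ≤ (expTrace P fun ω => X ω * star (X ω)).re ∧
      (expTrace P fun ω => X ω * star (X ω)).im = 0 := by
  have h : (expTrace P fun ω => X ω * star (X ω)) =
      (((n : ℝ)⁻¹ * ∫ ω, ∑ i, ∑ j, ‖X ω i j‖ ^ 2 ∂P : ℝ) : ℂ) := by
    simp_rw [expTrace, trace_mul_star_eq]
    rw [integral_complex_ofReal]
    push_cast
    rfl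
  rw [h]
  refine ⟨?_, Complex.ofReal_im _⟩
  rw [Complex.ofReal_re]
  exact mul_nonneg (by positivity) (integral_nonneg fun ω => by positivity)

/-- If all `*`-moments converge, their limits are the `*`-moments of elements of a
`*`-probability space. -/
lemma exists_limit_state {Ω : ℕ → Type*} [∀ n, MeasurableSpace (Ω n)]
    (P : ∀ n, Measure (Ω n)) [∀ n, IsProbabilityMeasure (P n)] {m : ℕ}
    (M : ∀ n, Fin m → Ω n → Matrix (Fin n) (Fin n) ℂ)
    (hint : ∀ n (p : ℕ) (τ : Fin p → Fin m) (ε : Fin p → StarExp),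
      Integrable (fun ω => (starWord (fun i => M n i ω) τ ε).trace) (P n))
    (μ : ∀ p : ℕ, (Fin p → Fin m) → (Fin p → StarExp) → ℂ)
    (hμ : ∀ (p : ℕ) (τ : Fin p → Fin m) (ε : Fin p → StarExp),
      Tendsto (fun n => expTrace (P n) (fun ω => starWord (fun i => M n i ω) τ ε)) atTop
        (𝓝 (μ p τ ε))) :
    ∃ φ : StarPoly m →ₗ[ℂ] ℂ, IsStarState φ ∧
      ∀ (p : ℕ) (τ : Fin p → Fin m) (ε : Fin p → StarExp),
        φ (starWord starPolyVar τ ε) = μ p τ ε := by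
  let μ' : FreeMonoid (Fin m × StarExp) → ℂ := fun w =>
    μ w.toList.length (fun t => (w.toList.get t).1) (fun t => (w.toList.get t).2)
  let φ : StarPoly m →ₗ[ℂ] ℂ :=
    (Finsupp.linearCombination ℂ μ').comp (MonoidAlgebra.coeffLinearEquiv ℂ).toLinearMap
  have hφ : ∀ w c, φ (MonoidAlgebra.single w c) = c * μ' w := by
    intro w c
    simp [φ]
  -- Convergence extends linearly from words to polynomials; integrability is carried along so that
  -- the integral is additive.
  have hlim : ∀ a : StarPoly m,
      (∀ n, Integrable (fun ω => (starPolyEval (fun i => M n i ω) a).trace) (P n)) ∧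
      Tendsto (fun n => expTrace (P n) (fun ω => starPolyEval (fun i => M n i ω) a)) atTop
        (𝓝 (φ a)) := by
    intro a
    induction a using MonoidAlgebra.induction_linear with
    | zero => simp [expTrace]
    | add a b ha hb =>
      simp only [map_add, Matrix.trace_add]
      refine ⟨fun n => (ha.1 n).add (hb.1 n), (ha.2.add hb.2).congr fun n => ?_⟩
      simp only [expTrace, Matrix.trace_add]
      rw [integral_add (ha.1 n) (hb.1 n), mul_add]
    | single w c =>
      set τ : Fin w.toList.length → Fin m := fun t => (w.toList.get t).1
      set ε : Fin w.toList.length → StarExp := fun t => (w.toList.get t).2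
      have hw : ∀ n ω, (starPolyEval (fun i => M n i ω) (MonoidAlgebra.single w c)).trace =
          c * (starWord (fun i => M n i ω) τ ε).trace := by
        intro n ω
        rw [starPolyEval_single, lift_eq_starWord (fun i => M n i ω), Matrix.trace_smul,
          smul_eq_mul]
      refine ⟨fun n => ?_, ?_⟩
      · simp_rw [hw]
        exact (hint n w.toList.length τ ε).const_mul c
      · rw [hφ]
        refine ((hμ w.toList.length τ ε).const_mul c).congr fun n => ?_
        simp_rw [expTrace, hw]
        rw [integral_const_mul]
        ring
  refine ⟨φ, ⟨?_, fun a => ?_⟩, fun p τ ε => ?_⟩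
  · refine tendsto_nhds_unique (hlim 1).2 (tendsto_const_nhds.congr' ?_)
    -- For n = 0 the normalized trace of the identity is 0, not 1.
    filter_upwards [eventually_ge_atTop 1] with n hn
    have hn' : (n : ℂ) ≠ 0 := by exact_mod_cast (by omega : n ≠ 0)
    simp [expTrace, hn']
  · have h := (hlim (a * star a)).2
    simp only [map_mul, starPolyEval_star] at h
    constructor
    · exact ge_of_tendsto' ((Complex.continuous_re.tendsto _).comp h)
        fun n => (expTrace_mul_star (P n) _).1
    · refine tendsto_nhds_unique ((Complex.continuous_im.tendsto _).comp h)
        (tendsto_const_nhds.congr fun n => ?_)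
      exact (expTrace_mul_star (P n) _).2.symm
  · have h := (hlim (starWord starPolyVar τ ε)).2
    simp only [starPolyEval_starWord] at h
    exact tendsto_nhds_unique h (hμ p τ ε)

end LimitState

/-! ### Convergence of the moments -/

section Moments

variable {Ω : ℕ → Type*} [∀ n, MeasurableSpace (Ω n)] {P : ∀ n, Measure (Ω n)}
  {m : ℕ} {ρ : Correlations}

/-- What the moment method uses about the input pairs `Z n (i, j)` of the `i`-th matrix. -/
structure PairFamily (P : ∀ n, Measure (Ω n)) (ρ : Correlations)
    (Z : ∀ n, Fin m × ℤ → Ω n → ℂ × ℂ) : Prop where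
  indep : ∀ n, iIndepFun (Z n) (P n)
  measurable : ∀ n b, Measurable (Z n b)
  mean : ∀ n η c b, ∫ ω, entry η c (Z n b ω) ∂P n = 0
  cov : ∀ n η c η' c' b,
    ∫ ω, entry η c (Z n b ω) * entry η' c' (Z n b ω) ∂P n = entryCov ρ η c η' c'
  moments : ∀ q : ℕ, 1 ≤ q → ∃ C : ℝ, ∀ n η c b,
    Integrable (fun ω => ‖entry η c (Z n b ω)‖ ^ q) (P n) ∧
      ∫ ω, ‖entry η c (Z n b ω)‖ ^ q ∂P n ≤ C

namespace PairFamily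

variable {Z : ∀ n, Fin m × ℤ → Ω n → ℂ × ℂ}

/-- Independence between the matrices and independence across j within each matrix combine into
joint independence over all (i, j). -/
lemma of_inputAssumption {x y u v : ∀ n, Fin m → ℤ → Ω n → ℝ}
    (hinput : ∀ i : Fin m, InputAssumption P ρ
      (fun n => x n i) (fun n => y n i) (fun n => u n i) (fun n => v n i))
    (hindep : ∀ n, iIndepFun
      (fun (i : Fin m) (ω : Ω n) (j : ℤ) =>
        (toComplex (x n i j) (y n i j) ω, toComplex (u n i j) (v n i j) ω)) (P n)) :
    PairFamily P ρ fun n b ω =>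
      (toComplex (x n b.1 b.2) (y n b.1 b.2) ω, toComplex (u n b.1 b.2) (v n b.1 b.2) ω) where
  indep n := iIndepFun_uncurry'
    (X := fun i j ω => (toComplex (x n i j) (y n i j) ω, toComplex (u n i j) (v n i j) ω))
    (fun i j => (hinput i).measurable_pair n j) (hindep n) fun i => (hinput i).indep n
  measurable n b := (hinput b.1).measurable_pair n b.2
  mean n η c b := (hinput b.1).integral_entry n η c b.2
  cov n η c η' c' b := (hinput b.1).integral_entry_mul_entry n η η' c c' b.2
  moments q hq := by
    choose C hC using fun i => (hinput i).exists_moment_bound hq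
    refine ⟨∑ i, |C i|, fun n η c b => ⟨(hC b.1 n η c b.2).1, ?_⟩⟩
    refine ((hC b.1 n η c b.2).2.trans (le_abs_self _)).trans ?_
    exact Finset.single_le_sum (f := fun i => |C i|) (fun i _ => abs_nonneg _) (Finset.mem_univ _)

variable {p : ℕ}

lemma exists_word_bound [∀ n, IsProbabilityMeasure (P n)] (hZ : PairFamily P ρ Z)
    (τ : Fin p → Fin m) (ε : Fin p → StarExp) :
    ∃ C : ℝ, ∀ n (w : Fin (p + 1) → Fin n),
      Integrable (fun ω => ∏ t, pathEntry ε w t (Z n (pathKey τ w t) ω)) (P n) ∧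
        ‖∫ ω, ∏ t, pathEntry ε w t (Z n (pathKey τ w t) ω) ∂P n‖ ≤ C := by
  obtain ⟨C, hC⟩ : ∃ C : ℝ, ∀ n η c b, 1 ≤ p →
      Integrable (fun ω => ‖entry η c (Z n b ω)‖ ^ p) (P n) ∧
        ∫ ω, ‖entry η c (Z n b ω)‖ ^ p ∂P n ≤ C := by
    by_cases hp : 1 ≤ p
    · obtain ⟨C, hC⟩ := hZ.moments p hp
      exact ⟨C, fun n η c b _ => hC n η c b⟩
    · exact ⟨0, fun n η c b h => absurd h hp⟩
  refine ⟨1 + p * C, fun n w => integrable_prod_and_bound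
    (fun t => (measurable_entry _ _).comp (hZ.measurable n _)) fun t => ?_⟩
  exact hC n _ _ _ (by have := t.isLt; omega)

lemma expTrace_word [∀ n, IsProbabilityMeasure (P n)] (hZ : PairFamily P ρ Z)
    (τ : Fin p → Fin m) (ε : Fin p → StarExp) (n : ℕ)
    (c : ℝ) :
    expTrace (P n) (fun ω => starWord (fun i =>
      (c : ℂ) • hankel n (fun j => (Z n (i, j) ω).1) (fun j => (Z n (i, j) ω).2)) τ ε) =
      (n : ℂ)⁻¹ * (c : ℂ) ^ p * ∑ w ∈ closedPaths n p,
        ∫ ω, ∏ t, pathEntry ε w t (Z n (pathKey τ w t) ω) ∂P n := by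
  obtain ⟨C, hC⟩ := hZ.exists_word_bound τ ε
  exact expTrace_starWord τ ε c (Z n) fun w _ => (hC n w).1

lemma integrable_trace_word [∀ n, IsProbabilityMeasure (P n)] (hZ : PairFamily P ρ Z)
    (τ : Fin p → Fin m) (ε : Fin p → StarExp)
    (n : ℕ) (c : ℝ) :
    Integrable (fun ω => (starWord (fun i =>
      (c : ℂ) • hankel n (fun j => (Z n (i, j) ω).1) (fun j => (Z n (i, j) ω).2)) τ ε).trace)
      (P n) := by
  obtain ⟨C, hC⟩ := hZ.exists_word_bound τ ε
  have e := fun ω => trace_starWord (n := n) τ ε c (fun b => Z n b ω)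
  simp_rw [e]
  exact (integrable_finsetSum _ fun w _ => (hC n w).1).const_mul _

lemma integral_eq_zero_of_single (hZ : PairFamily P ρ Z) {τ : Fin p → Fin m}
    (ε : Fin p → StarExp) {n : ℕ} {w : Fin (p + 1) → Fin n}
    (h : ∃ t, ∀ s, pathKey τ w s = pathKey τ w t → s = t) :
    ∫ ω, ∏ t, pathEntry ε w t (Z n (pathKey τ w t) ω) ∂P n = 0 :=
  integral_prod_eq_zero_of_single (hZ.indep n) (hZ.measurable n)
    (fun _ => measurable_entry _ _) (fun _ b => hZ.mean n _ _ b) h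

lemma tendsto_odd_moment [∀ n, IsProbabilityMeasure (P n)] (hZ : PairFamily P ρ Z)
    {k : ℕ} (τ : Fin (2 * k + 1) → Fin m)
    (ε : Fin (2 * k + 1) → StarExp) :
    Tendsto (fun n => expTrace (P n) (fun ω => starWord (fun i =>
      (((Real.sqrt n)⁻¹ : ℝ) : ℂ) • hankel n (fun j => (Z n (i, j) ω).1)
        (fun j => (Z n (i, j) ω).2)) τ ε)) atTop (𝓝 0) := by
  obtain ⟨C, hC⟩ := hZ.exists_word_bound τ ε
  simp_rw [hZ.expTrace_word]
  refine tendsto_degenerate τ _ (fun n w => (hC n w).2) fun n w hw hdeg => ?_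
  rcases fiber_trichotomy (pathKey τ w) with h | h | h
  · exact hZ.integral_eq_zero_of_single ε h
  · exact absurd (Finset.mem_filter.2 ⟨hw, h⟩) hdeg
  -- If every key occurred exactly twice, the length would be even.
  · have := two_mul_card_image_of_fibers h
    omega

/-- The covariance matrix of the entries along a path. -/
noncomputable def pathCov (ρ : Correlations) {n p : ℕ} (ε : Fin p → StarExp)
    (w : Fin (p + 1) → Fin n) (i j : Fin p) : ℂ :=
  entryCov ρ (ε i) (isLower (ε i) (w i.castSucc) (w i.succ)) (ε j)
    (isLower (ε j) (w j.castSucc) (w j.succ))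

lemma integral_eq_wickSum (hZ : PairFamily P ρ Z) {k : ℕ} {τ : Fin (2 * k) → Fin m}
    (ε : Fin (2 * k) → StarExp) {n : ℕ} {w : Fin (2 * k + 1) → Fin n}
    (hw : w ∈ closedPaths n (2 * k)) (hdeg : w ∉ degeneratePaths n τ) :
    ∫ ω, ∏ t, pathEntry ε w t (Z n (pathKey τ w t) ω) ∂P n =
      wickSum (pathKey τ w) (pathCov ρ ε w) := by
  rcases fiber_trichotomy (pathKey τ w) with h | h | h
  · rw [wickSum_eq_zero _ h, hZ.integral_eq_zero_of_single ε h]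
  · exact absurd (Finset.mem_filter.2 ⟨hw, h⟩) hdeg
  · obtain ⟨π, hπ⟩ := exists_pairPartition h
    rw [wickSum_eq_prod _ h hπ, integral_prod_eq_prod_pairs (hZ.indep n) (hZ.measurable n)
      (F := pathEntry ε w) (fun _ => measurable_entry _ _) h hπ]
    exact Finset.prod_congr rfl fun t _ => hZ.cov n _ _ _ _ _

end PairFamily

/-- Keys agree when both the matrix labels and the input indices agree. The labels do not depend on
the path and come out as Kronecker deltas. -/
lemma sum_wickSum (ρ : Correlations) {k : ℕ} (τ : Fin (2 * k) → Fin m)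
    (ε : Fin (2 * k) → StarExp) (n : ℕ) :
    ∑ w ∈ closedPaths n (2 * k), wickSum (pathKey τ w) (PairFamily.pathCov ρ ε w) =
      ∑ π : PairPartition k, (∏ t, (kron (τ (π.r t)) (τ (π.s t)) : ℂ)) *
        ∑ q ∈ Finset.Ico (0 : ℤ) n, ∑ J ∈ Fintype.piFinset fun _ : Fin k => Finset.Ico (-(n : ℤ)) n,
          latticeWeight π ε ρ n q J := by
  simp_rw [wickSum]
  rw [Finset.sum_comm]
  refine Finset.sum_congr rfl fun π _ => ?_
  rw [← sum_matched_paths, Finset.mul_sum]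
  refine Finset.sum_congr rfl fun w _ => ?_
  rw [← Finset.prod_mul_distrib]
  refine Finset.prod_congr rfl fun t _ => ?_
  simp only [pathKey, Prod.mk.injEq, kron, PairFamily.pathCov, ite_and]
  split_ifs <;> simp

lemma hankelMoment_eq (ρ : Correlations) {k : ℕ} (τ : Fin (2 * k) → Fin m)
    (ε : Fin (2 * k) → StarExp) :
    hankelMoment ρ τ ε = ∑ π : PairPartition k, (∏ t, (kron (τ (π.r t)) (τ (π.s t)) : ℂ)) *
      ∫ z₀ in Set.Icc (0 : ℝ) 1, ∫ z in Set.Icc (fun _ : Fin k => (-1 : ℝ)) (fun _ => 1),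
        ∏ t : Fin k, hankelE ρ π ε (π.r t) (π.s t) z₀ z := by
  rw [hankelMoment]
  refine Finset.sum_congr rfl fun π _ => ?_
  simp_rw [Finset.prod_mul_distrib, integral_const_mul]

lemma PairFamily.tendsto_even_moment [∀ n, IsProbabilityMeasure (P n)]
    {Z : ∀ n, Fin m × ℤ → Ω n → ℂ × ℂ} (hZ : PairFamily P ρ Z)
    {k : ℕ} (τ : Fin (2 * k) → Fin m) (ε : Fin (2 * k) → StarExp) :
    Tendsto (fun n => expTrace (P n) (fun ω => starWord (fun i =>
      (((Real.sqrt n)⁻¹ : ℝ) : ℂ) • hankel n (fun j => (Z n (i, j) ω).1)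
        (fun j => (Z n (i, j) ω).2)) τ ε)) atTop (𝓝 (hankelMoment ρ τ ε)) := by
  obtain ⟨C, hC⟩ := hZ.exists_word_bound τ ε
  obtain ⟨C', hC'0, hC'⟩ := exists_entryCov_bound ρ
  -- Expectation minus `wickSum` is uniformly bounded and vanishes off the degenerate paths.
  have herr := tendsto_degenerate τ (fun n w =>
    ∫ ω, ∏ t, pathEntry ε w t (Z n (pathKey τ w t) ω) ∂P n -
      wickSum (pathKey τ w) (PairFamily.pathCov ρ ε w))
    (C := C + Fintype.card (PairPartition k) * C' ^ k)
    (fun n w => (norm_sub_le _ _).trans (add_le_add (hC n w).2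
      (norm_wickSum_le _ (fun i j => hC' _ _ _ _) hC'0)))
    (fun n w hw hdeg => sub_eq_zero.2 (hZ.integral_eq_wickSum ε hw hdeg))
  have hmain := tendsto_finsetSum (Finset.univ : Finset (PairPartition k)) fun π _ =>
    (tendsto_sum_latticeWeight π ε ρ).const_mul (∏ t, (kron (τ (π.r t)) (τ (π.s t)) : ℂ))
  rw [← hankelMoment_eq] at hmain
  have hsum := herr.add hmain
  rw [zero_add] at hsum
  refine hsum.congr fun n => ?_
  have hc : (((Real.sqrt n)⁻¹ : ℝ) : ℂ) ^ (2 * k) = (n : ℂ)⁻¹ ^ k := by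
    rw [pow_mul, ← Complex.ofReal_pow, inv_pow, Real.sq_sqrt (Nat.cast_nonneg n)]
    push_cast
    rfl
  rw [hZ.expTrace_word, hc, Finset.sum_sub_distrib, sum_wickSum, mul_sub]
  have : ∀ π : PairPartition k, ∀ S : ℂ, (∏ t, (kron (τ (π.r t)) (τ (π.s t)) : ℂ)) *
      ((n : ℂ)⁻¹ * ((n : ℂ)⁻¹ ^ k * S)) =
      (n : ℂ)⁻¹ * (n : ℂ)⁻¹ ^ k * ((∏ t, (kron (τ (π.r t)) (τ (π.s t)) : ℂ)) * S) := by
    intro π S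
    ring
  simp_rw [this, ← Finset.mul_sum]
  ring

end Moments

theorem mainTheorem4 {Ω : ℕ → Type*} [∀ n, MeasurableSpace (Ω n)]
    (P : ∀ n, Measure (Ω n)) [∀ n, IsProbabilityMeasure (P n)]
    (m : ℕ) (ρ : Correlations) (x y u v : ∀ n, Fin m → ℤ → Ω n → ℝ)
    (hinput : ∀ i : Fin m, InputAssumption P ρ
      (fun n => x n i) (fun n => y n i) (fun n => u n i) (fun n => v n i))
    (hindep : ∀ n, iIndepFun
      (fun (i : Fin m) (ω : Ω n) (j : ℤ) =>
        (toComplex (x n i j) (y n i j) ω, toComplex (u n i j) (v n i j) ω)) (P n)) :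
    ∃ (A : Type) (_ : Ring A) (_ : StarRing A) (_ : Algebra ℂ A) (_ : StarModule ℂ A)
      (φ : A →ₗ[ℂ] ℂ) (h : Fin m → A),
      IsStarState φ ∧
      ConvergesInStarDistribution P
        (fun n i ω => (((Real.sqrt n)⁻¹ : ℝ) : ℂ) •
          hankel n (fun j => toComplex (x n i j) (y n i j) ω)
            (fun j => toComplex (u n i j) (v n i j) ω)) φ h ∧
      (∀ (k : ℕ) (τ : Fin (2 * k + 1) → Fin m) (ε : Fin (2 * k + 1) → StarExp),
        φ (starWord h τ ε) = 0) ∧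
      (∀ (k : ℕ) (τ : Fin (2 * k) → Fin m) (ε : Fin (2 * k) → StarExp),
        φ (starWord h τ ε) = hankelMoment ρ τ ε) := by

  have hZ := PairFamily.of_inputAssumption hinput hindep
  have hlim : ∀ (p : ℕ) (τ : Fin p → Fin m) (ε : Fin p → StarExp), ∃ l : ℂ,
      Tendsto (fun n => expTrace (P n) fun ω => starWord (fun i =>
        (((Real.sqrt n)⁻¹ : ℝ) : ℂ) • hankel n (fun j => toComplex (x n i j) (y n i j) ω)
          (fun j => toComplex (u n i j) (v n i j) ω)) τ ε) atTop (𝓝 l) := by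
    intro p
    obtain ⟨k, rfl | rfl⟩ := Nat.even_or_odd' p
    · exact fun τ ε => ⟨_, hZ.tendsto_even_moment τ ε⟩
    · exact fun τ ε => ⟨_, hZ.tendsto_odd_moment τ ε⟩
  -- One family of limits covers all lengths; uniqueness of limits later identifies its values by
  -- parity.
  choose μ hμ using hlim
  obtain ⟨φ, hφ, hφμ⟩ := exists_limit_state P _
    (fun n p τ ε => hZ.integrable_trace_word τ ε n (Real.sqrt n)⁻¹) μ hμ
  refine ⟨StarPoly m, inferInstance, inferInstance, inferInstance, inferInstance, φ, starPolyVar,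
    hφ, fun p τ ε => ?_, fun k τ ε => ?_, fun k τ ε => ?_⟩
  · rw [hφμ]
    exact hμ p τ ε
  · rw [hφμ]
    exact tendsto_nhds_unique (hμ _ τ ε) (hZ.tendsto_odd_moment τ ε)
  · rw [hφμ]
    exact tendsto_nhds_unique (hμ _ τ ε) (hZ.tendsto_even_moment τ ε)
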